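/- A degree distribution pair $(\lambda,\rho)$ consists of $\lambda(x)=\sum_i\lambda_i x^{i-1}$ and $\rho(x)=\sum_j\rho_j x^{j-1}$, finite sums over degrees $i,j\ge 1$ with nonnegative rational coefficients and $\sum_i\lambda_i=\sum_j\rho_j=1$. Let $k$ be the least common multiple of all $i$ with $\lambda_i\neq0$ and all $j$ with $\rho_j\ne 0$, let $L_i=\frac{\lambda_i/i}{\sum_l\lambda_l/l}$ and $L(x)=\sum_i L_ix^i$. For $\epsilon\in[0,1]$ let $x_0=y_0=\epsilon$ and, for $t\ge1$, $x_t=\epsilon\lambda(1-\rho(1-x_{t-1}))$ and $y_t(\epsilon)=\epsilon L(1-\rho(1-x_{t-1}))$. Let $n_0$ be such that all $n_0\lambda_i$ and $n_0\rho_j$ are integers, and let $G$ be a simple $k$-regular bipartite graph with left vertices $v_1,\dots,v_{n_0}$, right vertices $c_1,\dots,c_{n_0}$ and a fixed ordering of its edges. Choose two independent uniformly random permutations $\sigma,\pi$ of $\{1,\dots,n_0\}$. In the list $v_{\sigma(1)},\dots,v_{\sigma(n_0)}$, assign degree $1$ to the first $n_0\lambda_1$ vertices, degree $2$ to the next $n_0\lambda_2$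 vertices, and so on, and split each vertex of assigned degree $i$ into $k/i$ variable nodes of degree $i$: the first $i$ of its edges, in the given ordering, go to the first new node, the next $i$ edges to the second one, and so on. Split the right vertices into check nodes in the same way, using $\pi$ and $\rho$. Let $C_n$ be the binary linear code of the resulting Tanner graph, which has $n=n_0k\int_0^1\lambda(x)\,dx$ variable nodes. Let $P_b^{\mathrm{MP}}(C_n,\epsilon,t)$ be the probability that a uniformly random bit of a uniformly random codeword of $C_n$, sent over the binary erasure channel with erasure probability $\epsilon$, is unknown after $t$ iterations of message-passing decoding, and let $\mathbb E(\cdot\mid G)$ be the expectation over $\sigma,\pi$. Then for every $(\lambda,\rho)$ there is a constant $a_0>0$ such that for every $a\in(0,a_0]$ and every $\delta\in(0,1)$ there is an $N$ with the following property. For all block-lengths $n\ge N$ of the above form, with $t(n)=\lfloor a\log n\rfloor$, for all $G$ as above of girth at least $4t(n)+2$ and all $\epsilon\in[0,1]$, $$\mathbb E\bigl(P_b^{\mathrm{MP}}(C_n,\epsilon,t(n))\,\big|\,G\bigr)\le\frac{1}{1-\delta}\,y_{t(n)}(\epsilon).$$ -/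

import Mathlib

/-- A Tanner graph (bipartite multigraph) with variable nodes `V`, check nodes `C` and edges `E`:
each edge has one variable-node end and one check-node end. -/
structure TannerGraph (V C E : Type*) where
  var : E → V
  chk : E → C

namespace TannerGraph

variable {V C E : Type*} [Fintype V] [Fintype C] [Fintype E]

open scoped Classical in
/-- The binary linear code of a Tanner graph: the words that satisfy all parity checks. -/
noncomputable def code (T : TannerGraph V C E) : Finset (V → ZMod 2) :=
  Finset.univ.filter fun x => ∀ c : C, ∑ e : E with T.chk e = c, x (T.var e) = 0

open scoped Classical in
/-- The output of the binary erasure channel: the bits in `S` are erased (`none`). -/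
noncomputable def received (x : V → ZMod 2) (S : Finset V) (v : V) : Option (ZMod 2) :=
  if v ∈ S then none else some (x v)

open scoped Classical in
/-- Variable-node rule: from the received symbol `o` and the check-to-variable messages `m` on the
edges in `S`, output a known value if there is one (over the erasure channel all known values
agree, so it does not matter which one is taken), and an erasure otherwise. -/
noncomputable def varRule (o : Option (ZMod 2)) (S : Finset E) (m : E → Option (ZMod 2)) :
    Option (ZMod 2) :=
  if h : ∃ b : ZMod 2, o = some b ∨ ∃ e ∈ S, m e = some b then some h.choose else none

open scoped Classical in
/-- Check-node rule: the sum of the variable-to-check messages `m` on the edges in `S` if none of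
them is an erasure, and an erasure otherwise. -/
noncomputable def chkRule (S : Finset E) (m : E → Option (ZMod 2)) : Option (ZMod 2) :=
  if ∀ e ∈ S, m e ≠ none then some (∑ e ∈ S, (m e).getD 0) else none

open scoped Classical in
/-- Variable-to-check messages, computed from the check-to-variable messages `m`: the message on
`e` uses the received symbol and the messages on the other edges at the same variable node. -/
noncomputable def varToChk (T : TannerGraph V C E) (r : V → Option (ZMod 2))
    (m : E → Option (ZMod 2)) (e : E) : Option (ZMod 2) :=
  varRule (r (T.var e)) (Finset.univ.filter fun e' => e' ≠ e ∧ T.var e' = T.var e) m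

open scoped Classical in
/-- Check-to-variable messages after `t` iterations of message passing; before the first
iteration all of them are erasures. -/
noncomputable def chkToVar (T : TannerGraph V C E) (r : V → Option (ZMod 2)) :
    ℕ → E → Option (ZMod 2)
  | 0, _ => none
  | t + 1, e =>
      chkRule (Finset.univ.filter fun e' => e' ≠ e ∧ T.chk e' = T.chk e)
        (T.varToChk r (chkToVar T r t))

open scoped Classical in
/-- The decoder's estimate of bit `v` after `t` iterations (`none` if it is unknown). -/
noncomputable def estimate (T : TannerGraph V C E) (r : V → Option (ZMod 2)) (t : ℕ) (v : V) :
    Option (ZMod 2) :=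
  varRule (r v) (Finset.univ.filter fun e => T.var e = v) (T.chkToVar r t)

open scoped Classical in
/-- The bit-error probability after `t` iterations of message passing: a uniformly random codeword
is sent over the binary erasure channel with erasure probability `ε`, and a uniformly random
bit is looked at; this is the probability that it is still unknown. -/
noncomputable def bitErrorProb (T : TannerGraph V C E) (ε : ℝ) (t : ℕ) : ℝ :=
  (∑ x ∈ T.code, ∑ S : Finset V,
      ε ^ S.card * (1 - ε) ^ (Fintype.card V - S.card) *
        (((Finset.univ.filter fun v => T.estimate (received x S) t v = none).card : ℝ)
          / (Fintype.card V : ℝ)))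
    / (T.code.card : ℝ)

end TannerGraph

/-- A degree distribution from the edge perspective: `coeff i` is the (rational) fraction of edges
that are incident with nodes of degree `i`; there are finitely many degrees, all positive. -/
structure DegreeDistribution where
  coeff : ℕ →₀ ℚ
  coeff_nonneg : ∀ i, 0 ≤ coeff i
  coeff_zero : coeff 0 = 0
  sum_coeff : ∑ i ∈ coeff.support, coeff i = 1

namespace DegreeDistribution

/-- The edge-perspective polynomial `∑ i, coeff i * x ^ (i - 1)`. -/
noncomputable def edgePoly (d : DegreeDistribution) (x : ℝ) : ℝ :=
  ∑ i ∈ d.coeff.support, (d.coeff i : ℝ) * x ^ (i - 1)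

/-- The fraction of nodes that have degree `i`. -/
noncomputable def nodeFraction (d : DegreeDistribution) (i : ℕ) : ℝ :=
  ((d.coeff i : ℝ) / i) / ∑ j ∈ d.coeff.support, (d.coeff j : ℝ) / j

/-- The node-perspective polynomial `∑ i, L i * x ^ i`. -/
noncomputable def nodePoly (d : DegreeDistribution) (x : ℝ) : ℝ :=
  ∑ i ∈ d.coeff.support, d.nodeFraction i * x ^ i

/-- The degree that is assigned to slot `i` (counted from `0`) of an ordered list of `n₀`
vertices: the first `n₀ * coeff 1` slots get degree `1`, the next `n₀ * coeff 2` slots get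
degree `2`, and so on. -/
noncomputable def slotDegree (d : DegreeDistribution) (n₀ i : ℕ) : ℕ :=
  sInf {j : ℕ | (i : ℚ) < n₀ * ∑ l ∈ Finset.range (j + 1), d.coeff l}

theorem slotDegree_mem_support (d : DegreeDistribution) {n₀ i : ℕ} (hi : i < n₀) :
    d.slotDegree n₀ i ∈ d.coeff.support := by
  have hne : {j : ℕ | (i : ℚ) < n₀ * ∑ l ∈ Finset.range (j + 1), d.coeff l}.Nonempty := by
    refine ⟨d.coeff.support.sup id, ?_⟩
    have hsub : d.coeff.support ⊆ Finset.range (d.coeff.support.sup id + 1) := fun j hj =>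
      Finset.mem_range.2 (Nat.lt_succ_of_le (Finset.le_sup (f := id) hj))
    have hs : ∑ l ∈ Finset.range (d.coeff.support.sup id + 1), d.coeff l = 1 := by
      rw [← d.sum_coeff]
      exact (Finset.sum_subset hsub fun x _ hx => Finsupp.notMem_support_iff.1 hx).symm
    change (i : ℚ) < n₀ * _
    rw [hs, mul_one]
    exact_mod_cast hi
  have hmem : (i : ℚ) < n₀ * ∑ l ∈ Finset.range
      (sInf {j : ℕ | (i : ℚ) < n₀ * ∑ l ∈ Finset.range (j + 1), d.coeff l} + 1), d.coeff l :=
    Nat.sInf_mem hne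
  rw [Finsupp.mem_support_iff]
  intro h0
  change d.coeff (sInf _) = 0 at h0
  rw [Finset.sum_range_succ, h0, add_zero] at hmem
  rcases hz : sInf {j : ℕ | (i : ℚ) < n₀ * ∑ l ∈ Finset.range (j + 1), d.coeff l} with _ | m
  · rw [hz] at hmem
    simp only [Finset.range_zero, Finset.sum_empty, mul_zero] at hmem
    exact absurd hmem (not_lt.2 (Nat.cast_nonneg i))
  · rw [hz] at hmem
    exact Nat.notMem_of_lt_sInf (by rw [hz]; exact Nat.lt_succ_self m) hmem

/-- The nodes that arise when the vertex in slot `i` is split into `k / slotDegree` new nodes, for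
each of the `n₀` slots. -/
abbrev SplitNode (d : DegreeDistribution) (n₀ k : ℕ) : Type :=
  Σ i : Fin n₀, Fin (k / d.slotDegree n₀ i)

end DegreeDistribution

/-- The position of the edge `e` among the edges at the same end, in the given ordering. -/
def edgeRank {M n₀ : ℕ} (f : Fin M → Fin n₀) (e : Fin M) : ℕ :=
  (Finset.univ.filter fun e' => e' < e ∧ f e' = f e).card

theorem edgeRank_lt {M n₀ k : ℕ} (f : Fin M → Fin n₀)
    (hf : ∀ u, (Finset.univ.filter fun e => f e = u).card = k) (e : Fin M) :
    edgeRank f e < k := by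
  rw [← hf (f e)]
  refine Finset.card_lt_card ⟨fun x hx => ?_, fun h => ?_⟩
  · simp only [Finset.mem_filter, Finset.mem_univ, true_and] at hx ⊢
    exact hx.2
  · have he : e ∈ Finset.univ.filter fun e' => e' < e ∧ f e' = f e := h (by simp)
    simp at he

/-- Deterministic splitting. Here `f e` is the end of `e` on one side of a `k`-regular graph and
the vertex in slot `i` is the vertex `τ i`. That vertex is split into `k / j` new nodes, where `j`
is the degree assigned to slot `i`; the first `j` of its edges go to the first new node, the next
`j` edges to the second one, and so on. -/
noncomputable def splitEnd (d : DegreeDistribution) {n₀ M k : ℕ}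
    (hk : ∀ j ∈ d.coeff.support, j ∣ k) (f : Fin M → Fin n₀)
    (hf : ∀ u, (Finset.univ.filter fun e => f e = u).card = k)
    (τ : Equiv.Perm (Fin n₀)) (e : Fin M) : d.SplitNode n₀ k :=
  ⟨τ.symm (f e), ⟨edgeRank f e / d.slotDegree n₀ (τ.symm (f e)),
    Nat.div_lt_div_of_lt_of_dvd (hk _ (d.slotDegree_mem_support (τ.symm (f e)).isLt))
      (edgeRank_lt f hf e)⟩⟩

/-- A simple `k`-regular bipartite graph with `n₀` left and `n₀` right vertices, together with
orderings of its left vertices, of its right vertices and of its edges. -/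
structure OrderedRegularBipartiteGraph (n₀ k : ℕ) where
  left : Fin (n₀ * k) → Fin n₀
  right : Fin (n₀ * k) → Fin n₀
  simple : Function.Injective fun e => (left e, right e)
  left_regular : ∀ u, (Finset.univ.filter fun e => left e = u).card = k
  right_regular : ∀ u, (Finset.univ.filter fun e => right e = u).card = k

/-- The underlying simple graph. -/
def OrderedRegularBipartiteGraph.toSimpleGraph {n₀ k : ℕ}
    (G : OrderedRegularBipartiteGraph n₀ k) : SimpleGraph (Fin n₀ ⊕ Fin n₀) :=
  SimpleGraph.fromRel fun x y => ∃ e, x = Sum.inl (G.left e) ∧ y = Sum.inr (G.right e)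

/-- A degree distribution pair: `lam` for the variable nodes, `rho` for the check nodes. -/
structure DegreeDistributionPair where
  lam : DegreeDistribution
  rho : DegreeDistribution

namespace DegreeDistributionPair

/-- The least common multiple of all left and right degrees. -/
def degLcm (P : DegreeDistributionPair) : ℕ :=
  (P.lam.coeff.support ∪ P.rho.coeff.support).lcm id

/-- All products `n₀ * λ i` and `n₀ * ρ j` are natural numbers, so that the vertices on each side
of a graph with `n₀` left and `n₀` right vertices can be allotted to the degrees. -/
def Admissible (P : DegreeDistributionPair) (n₀ : ℕ) : Prop :=
  (∀ i, ∃ m : ℕ, (n₀ : ℚ) * P.lam.coeff i = m) ∧ (∀ j, ∃ m : ℕ, (n₀ : ℚ) * P.rho.coeff j = m)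

/-- The number of variable nodes of the irregular Tanner graphs that are built from a graph with
`n₀` left and `n₀` right vertices. -/
noncomputable def blockLength (P : DegreeDistributionPair) (n₀ : ℕ) : ℕ :=
  Fintype.card (P.lam.SplitNode n₀ P.degLcm)

/-- The irregular Tanner graph obtained from `G` by deterministic splitting, with the left vertices
arranged by `σ` and the right vertices arranged by `π`. -/
noncomputable def tannerGraph (P : DegreeDistributionPair) {n₀ : ℕ}
    (G : OrderedRegularBipartiteGraph n₀ P.degLcm) (σ π : Equiv.Perm (Fin n₀)) :
    TannerGraph (P.lam.SplitNode n₀ P.degLcm) (P.rho.SplitNode n₀ P.degLcm)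
      (Fin (n₀ * P.degLcm)) where
  var := splitEnd P.lam
    (fun _ hj => Finset.dvd_lcm (f := id) (Finset.mem_union_left _ hj)) G.left G.left_regular σ
  chk := splitEnd P.rho
    (fun _ hj => Finset.dvd_lcm (f := id) (Finset.mem_union_right _ hj)) G.right G.right_regular π

/-- The conditional expectation, given `G`, of the bit-error probability after `t` iterations: the
permutations `σ` and `π` are independent and uniformly distributed. -/
noncomputable def expectedBitErrorProb (P : DegreeDistributionPair) {n₀ : ℕ}
    (G : OrderedRegularBipartiteGraph n₀ P.degLcm) (ε : ℝ) (t : ℕ) : ℝ :=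
  (∑ σ : Equiv.Perm (Fin n₀), ∑ π : Equiv.Perm (Fin n₀), (P.tannerGraph G σ π).bitErrorProb ε t)
    / ((Fintype.card (Equiv.Perm (Fin n₀)) : ℝ) * (Fintype.card (Equiv.Perm (Fin n₀)) : ℝ))

/-- Density evolution for the edges: `x 0 = ε` and `x (t + 1) = ε * λ (1 - ρ (1 - x t))`. -/
noncomputable def x (P : DegreeDistributionPair) (ε : ℝ) : ℕ → ℝ
  | 0 => ε
  | t + 1 => ε * P.lam.edgePoly (1 - P.rho.edgePoly (1 - P.x ε t))

/-- Density evolution for the nodes: `y (t + 1) = ε * L (1 - ρ (1 - x t))`; before the first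
iteration, `y 0 = ε`. -/
noncomputable def y (P : DegreeDistributionPair) (ε : ℝ) : ℕ → ℝ
  | 0 => ε
  | t + 1 => ε * P.lam.nodePoly (1 - P.rho.edgePoly (1 - P.x ε t))

end DegreeDistributionPair

/-! By the girth hypothesis, the messages that determine the nodes of one left vertex after `t`
iterations live on a tree in the base graph, whatever the permutations are: splitting vertices only
removes dependencies. Replace the two permutations by arbitrary functions, so that every vertex
draws an independent uniform slot. Since exactly n₀λ_i left slots and n₀ρ_j right slots have degrees
i and j, the degrees and erasures on the tree are then independent and density evolution is exact.
By `prodExpect_rootMsg`, the mean number of erased nodes at a left vertex is n·y_t/n₀.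

Returning to permutations means sampling without replacement. If a nonnegative quantity depends on
at most m vertices of each side, then 1 - 2m²/n₀ times its average over permutations is at most its
average over functions (`two_perm_average_le`). This is applied to one root at a time, where m =
K^(2t+1) with K = k + 2 suffices (`card_rootSupport_lt`), and then summed over the n₀ roots. For t ≤
log n / (8 log K) one gets m² ≤ K²√n, while n₀ ≥ n/k, so 2m²/n₀ ≤ δ once n is large.

The link to the decoder is that over the erasure channel the set of erased messages depends on the
set of erased bits but not on the codeword. Hence the number of unknown bits is a sum of products of
indicators (`card_unknown_eq`). -/

/-! ### Walks without backtracking below the girth -/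

namespace SimpleGraph

/-- The edges of `p` and `q` together span a subgraph with too few edges to contain a cycle of `G`.
In this acyclic subgraph both walks are paths, and paths with given ends are unique. -/
theorem Walk.eq_of_isChain_of_length_lt_egirth {V : Type*} {G : SimpleGraph V} {u w : V}
    (p q : G.Walk u w) (hp : p.edges.IsChain (· ≠ ·)) (hq : q.edges.IsChain (· ≠ ·))
    (h : ((p.length + q.length : ℕ) : ℕ∞) < G.egirth) : p = q := by
  set H : SimpleGraph V := fromEdgeSet {e | e ∈ p.edges ∨ e ∈ q.edges} with hH
  have hHE : ∀ e, e ∈ H.edgeSet → e ∈ p.edges ∨ e ∈ q.edges := by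
    intro e he
    rw [hH, edgeSet_fromEdgeSet] at he
    exact he.1
  have hle : H ≤ G := by
    rw [← edgeSet_subset_edgeSet]
    intro e he
    rcases hHE e he with h | h
    exacts [p.edges_subset_edgeSet h, q.edges_subset_edgeSet h]
  have hpH : ∀ e ∈ p.edges, e ∈ H.edgeSet := fun e he => by
    rw [hH, edgeSet_fromEdgeSet]
    exact ⟨Or.inl he, fun hd => G.not_isDiag_of_mem_edgeSet (p.edges_subset_edgeSet he) hd⟩
  have hqH : ∀ e ∈ q.edges, e ∈ H.edgeSet := fun e he => by
    rw [hH, edgeSet_fromEdgeSet]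
    exact ⟨Or.inr he, fun hd => G.not_isDiag_of_mem_edgeSet (q.edges_subset_edgeSet he) hd⟩
  have hac : H.IsAcyclic := by
    intro a c hc
    have h1 : c.edges ⊆ p.edges ++ q.edges := fun e he =>
      List.mem_append.2 (hHE e (c.edges_subset_edgeSet he))
    have h2 : c.length ≤ p.length + q.length := by
      have := (hc.edges_nodup.subperm h1).length_le
      simpa using this
    have h3 : G.egirth ≤ (c.mapLe hle).length := egirth_le_length (hc.mapLe hle)
    rw [Walk.length_map] at h3
    exact absurd (h.trans_le h3) (not_lt.2 (by exact_mod_cast h2))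
  have hp' : (p.transfer H hpH).IsPath := by
    rw [hac.isPath_iff_isChain, Walk.edges_transfer]
    exact hp
  have hq' : (q.transfer H hqH).IsPath := by
    rw [hac.isPath_iff_isChain, Walk.edges_transfer]
    exact hq
  have heq := congrArg Subtype.val ((hac.subsingleton_path u w).elim ⟨_, hp'⟩ ⟨_, hq'⟩)
  -- `transfer` does not change the list of visited vertices, so equality in `H` gives equality in
  -- `G`.
  apply Walk.ext_support
  have := congrArg Walk.support heq
  simpa using this

/-- There is a walk without backtracking from `u` to `w` of length at most `l` with first
edge `s`. -/
def NonbacktrackingReach {V : Type*} (G : SimpleGraph V) (l : ℕ) (s : Sym2 V) (u w : V) : Prop :=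
  ∃ p : G.Walk u w, p.edges.IsChain (· ≠ ·) ∧ p.length ≤ l ∧ p.edges.head? = some s

theorem NonbacktrackingReach.of_adj {V : Type*} {G : SimpleGraph V} {u w : V} (h : G.Adj u w)
    {l : ℕ} (hl : 1 ≤ l) : G.NonbacktrackingReach l s(u, w) u w :=
  ⟨Walk.cons h Walk.nil, by simp, by simpa using hl, by simp⟩

theorem NonbacktrackingReach.cons {V : Type*} {G : SimpleGraph V} {u v w : V} {l : ℕ} {s : Sym2 V}
    (h : G.NonbacktrackingReach l s v w) (huv : G.Adj u v) (hs : s(u, v) ≠ s) :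
    G.NonbacktrackingReach (l + 1) s(u, v) u w := by
  obtain ⟨p, hp, hl, hh⟩ := h
  refine ⟨Walk.cons huv p, ?_, by simpa using hl, by simp⟩
  rw [Walk.edges_cons, List.isChain_cons, hh]
  exact ⟨by simpa using hs, hp⟩

/-- This is the form in which the tree property is used: different branches at a vertex reach
disjoint sets of vertices. -/
theorem NonbacktrackingReach.first_edge_unique {V : Type*} {G : SimpleGraph V} {u w : V}
    {l l' : ℕ} {s s' : Sym2 V} (h : G.NonbacktrackingReach l s u w)
    (h' : G.NonbacktrackingReach l' s' u w) (hg : ((l + l' : ℕ) : ℕ∞) < G.egirth) : s = s' := by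
  obtain ⟨p, hp, hl, hh⟩ := h
  obtain ⟨q, hq, hl', hh'⟩ := h'
  have := Walk.eq_of_isChain_of_length_lt_egirth p q hp hq
    (lt_of_le_of_lt (by exact_mod_cast add_le_add hl hl') hg)
  subst this
  simpa [hh] using hh'

theorem NonbacktrackingReach.ne {V : Type*} {G : SimpleGraph V} {u w : V}
    {l : ℕ} {s : Sym2 V} (h : G.NonbacktrackingReach l s u w) (hg : (l : ℕ∞) < G.egirth) :
    u ≠ w := by
  rintro rfl
  obtain ⟨p, hp, hl, hh⟩ := h
  have := Walk.eq_of_isChain_of_length_lt_egirth p Walk.nil hp (by simp)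
    (lt_of_le_of_lt (by simpa using hl) hg)
  subst this
  simp at hh

end SimpleGraph

/-! ### Computation neighbourhoods in the base graph -/

namespace OrderedRegularBipartiteGraph

variable {n₀ k : ℕ} (G : OrderedRegularBipartiteGraph n₀ k)

/-- The vertices on which the check-to-variable message along an edge after `t` iterations
depends. -/
def checkMsgSupport : ℕ → Fin (n₀ * k) → Finset (Fin n₀ ⊕ Fin n₀)
  | 0, _ => ∅
  | t + 1, e => insert (Sum.inr (G.right e))
      ((Finset.univ.filter fun e' => e' ≠ e ∧ G.right e' = G.right e).biUnion fun e' =>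
        insert (Sum.inl (G.left e'))
          ((Finset.univ.filter fun e'' => e'' ≠ e' ∧ G.left e'' = G.left e').biUnion
            (checkMsgSupport t)))

/-- The vertices on which the variable-to-check message along an edge, computed from the
check-to-variable messages after `t` iterations, depends. -/
def varMsgSupport (t : ℕ) (e : Fin (n₀ * k)) : Finset (Fin n₀ ⊕ Fin n₀) :=
  insert (Sum.inl (G.left e))
    ((Finset.univ.filter fun e' => e' ≠ e ∧ G.left e' = G.left e).biUnion (G.checkMsgSupport t))

theorem checkMsgSupport_succ (t : ℕ) (e : Fin (n₀ * k)) :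
    G.checkMsgSupport (t + 1) e = insert (Sum.inr (G.right e))
      ((Finset.univ.filter fun e' => e' ≠ e ∧ G.right e' = G.right e).biUnion
        (G.varMsgSupport t)) := rfl

/-- The edge `e` as an edge of the underlying simple graph. -/
def toSym2 (e : Fin (n₀ * k)) : Sym2 (Fin n₀ ⊕ Fin n₀) :=
  s(Sum.inl (G.left e), Sum.inr (G.right e))

theorem toSym2_injective : Function.Injective G.toSym2 := by
  intro e e' h
  simp only [toSym2, Sym2.eq_iff, Sum.inl.injEq, Sum.inr.injEq, reduceCtorEq, and_false,
    or_false] at h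
  exact G.simple (Prod.ext h.1 h.2)

theorem adj_left_right (e : Fin (n₀ * k)) :
    G.toSimpleGraph.Adj (Sum.inl (G.left e)) (Sum.inr (G.right e)) := by
  rw [toSimpleGraph, SimpleGraph.fromRel_adj]
  exact ⟨by simp, Or.inl ⟨e, rfl, rfl⟩⟩

/-- A message never uses the edge along which it is sent, so following the recursion traces a walk
without backtracking. The claim for check messages is a hypothesis here because this is half of the
induction step in the next theorem. -/
theorem nonbacktrackingReach_of_mem_varMsgSupport {t : ℕ}
    (ih : ∀ (e : Fin (n₀ * k)), ∀ w ∈ G.checkMsgSupport t e,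
      G.toSimpleGraph.NonbacktrackingReach (2 * t) (G.toSym2 e) (Sum.inl (G.left e)) w)
    (e : Fin (n₀ * k)) (w : Fin n₀ ⊕ Fin n₀) (hw : w ∈ G.varMsgSupport t e) :
    G.toSimpleGraph.NonbacktrackingReach (2 * t + 1) (G.toSym2 e) (Sum.inr (G.right e)) w := by
  rw [varMsgSupport, Finset.mem_insert, Finset.mem_biUnion] at hw
  rw [toSym2, Sym2.eq_swap]
  rcases hw with rfl | ⟨e', he', hw⟩
  · exact .of_adj (G.adj_left_right e).symm (by lia)
  · simp only [Finset.mem_filter, Finset.mem_univ, true_and] at he'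
    have h := ih e' w hw
    rw [he'.2] at h
    refine h.cons (G.adj_left_right e).symm ?_
    rw [Sym2.eq_swap]
    exact fun h => he'.1 (G.toSym2_injective h).symm

theorem nonbacktrackingReach_of_mem_checkMsgSupport (t : ℕ) (e : Fin (n₀ * k))
    (w : Fin n₀ ⊕ Fin n₀) (hw : w ∈ G.checkMsgSupport t e) :
    G.toSimpleGraph.NonbacktrackingReach (2 * t) (G.toSym2 e) (Sum.inl (G.left e)) w := by
  induction t generalizing e w with
  | zero => simp [checkMsgSupport] at hw
  | succ t ih =>
    rw [checkMsgSupport_succ, Finset.mem_insert, Finset.mem_biUnion] at hw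
    rcases hw with rfl | ⟨e', he', hw⟩
    · exact .of_adj (G.adj_left_right e) (by lia)
    · simp only [Finset.mem_filter, Finset.mem_univ, true_and] at he'
      have h := G.nonbacktrackingReach_of_mem_varMsgSupport ih e' w hw
      rw [he'.2] at h
      exact h.cons (G.adj_left_right e) fun h => he'.1 (G.toSym2_injective h).symm

theorem left_notMem_checkMsgSupport {t : ℕ}
    (hg : ((4 * t + 2 : ℕ) : ℕ∞) ≤ G.toSimpleGraph.egirth) (e : Fin (n₀ * k)) :
    Sum.inl (G.left e) ∉ G.checkMsgSupport t e := fun h =>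
  (G.nonbacktrackingReach_of_mem_checkMsgSupport t e _ h).ne
    (lt_of_lt_of_le (by norm_cast; lia) hg) rfl

theorem right_notMem_varMsgSupport {t : ℕ}
    (hg : ((4 * (t + 1) + 2 : ℕ) : ℕ∞) ≤ G.toSimpleGraph.egirth) (e : Fin (n₀ * k)) :
    Sum.inr (G.right e) ∉ G.varMsgSupport t e := fun h =>
  (G.nonbacktrackingReach_of_mem_varMsgSupport
    (G.nonbacktrackingReach_of_mem_checkMsgSupport t) e _ h).ne
    (lt_of_lt_of_le (by norm_cast; lia) hg) rfl

/-- A common vertex would be reached from the same left vertex by two walks with different first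
edges and total length at most 4t, below the girth. -/
theorem disjoint_checkMsgSupport {t : ℕ}
    (hg : ((4 * t + 2 : ℕ) : ℕ∞) ≤ G.toSimpleGraph.egirth) {e e' : Fin (n₀ * k)} (hne : e ≠ e')
    (hl : G.left e = G.left e') : Disjoint (G.checkMsgSupport t e) (G.checkMsgSupport t e') := by
  rw [Finset.disjoint_left]
  intro w hw hw'
  have h := G.nonbacktrackingReach_of_mem_checkMsgSupport t e w hw
  have h' := G.nonbacktrackingReach_of_mem_checkMsgSupport t e' w hw'
  rw [← hl] at h'
  exact hne (G.toSym2_injective (h.first_edge_unique h'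
    (lt_of_lt_of_le (by norm_cast; lia) hg)))

/-- Here the two walks have total length up to 4t + 2, which is why the girth bound is taken for `t
+ 1`. -/
theorem disjoint_varMsgSupport {t : ℕ}
    (hg : ((4 * (t + 1) + 2 : ℕ) : ℕ∞) ≤ G.toSimpleGraph.egirth) {e e' : Fin (n₀ * k)}
    (hne : e ≠ e') (hr : G.right e = G.right e') :
    Disjoint (G.varMsgSupport t e) (G.varMsgSupport t e') := by
  rw [Finset.disjoint_left]
  intro w hw hw'
  have h := G.nonbacktrackingReach_of_mem_varMsgSupport
    (G.nonbacktrackingReach_of_mem_checkMsgSupport t) e w hw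
  have h' := G.nonbacktrackingReach_of_mem_varMsgSupport
    (G.nonbacktrackingReach_of_mem_checkMsgSupport t) e' w hw'
  rw [← hr] at h'
  exact hne (G.toSym2_injective (h.first_edge_unique h'
    (lt_of_lt_of_le (by norm_cast; lia) hg)))

/-- The vertices on which the messages that arrive at the left vertex `u` depend, together
with `u`. -/
def rootSupport (t : ℕ) (u : Fin n₀) : Finset (Fin n₀ ⊕ Fin n₀) :=
  insert (Sum.inl u) ((Finset.univ.filter fun e => G.left e = u).biUnion (G.checkMsgSupport t))

/-- There are at most k branches and one further vertex, and kX + 1 < (k + 2)X. The supports thus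
grow by a factor of at most k + 2 per layer. -/
theorem card_insert_biUnion_lt {s : Finset (Fin (n₀ * k))} (hs : s.card ≤ k)
    {f : Fin (n₀ * k) → Finset (Fin n₀ ⊕ Fin n₀)} {X : ℕ} (hX : 0 < X)
    (hf : ∀ e, (f e).card < X) (v : Fin n₀ ⊕ Fin n₀) :
    (insert v (s.biUnion f)).card < (k + 2) * X := by
  have h1 : (s.biUnion f).card ≤ s.card * X :=
    Finset.card_biUnion_le_card_mul _ _ _ fun e _ => (hf e).le
  have h2 := Finset.card_insert_le v (s.biUnion f)
  have h3 : s.card * X ≤ k * X := Nat.mul_le_mul_right X hs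
  nlinarith

theorem card_checkMsgSupport_lt (t : ℕ) (e : Fin (n₀ * k)) :
    (G.checkMsgSupport t e).card < (k + 2) ^ (2 * t) := by
  induction t generalizing e with
  | zero => simp [checkMsgSupport]
  | succ t ih =>
    rw [checkMsgSupport_succ, show 2 * (t + 1) = (2 * t + 1) + 1 by ring, pow_succ',
      pow_succ']
    refine card_insert_biUnion_lt ?_ (by positivity) (fun e' => ?_) _
    · refine le_trans (Finset.card_le_card fun x hx => ?_) (G.right_regular (G.right e)).le
      simp_all
    · refine card_insert_biUnion_lt ?_ (by positivity) ih _
      refine le_trans (Finset.card_le_card fun x hx => ?_) (G.left_regular (G.left e')).le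
      simp_all

theorem card_rootSupport_lt (t : ℕ) (u : Fin n₀) :
    (G.rootSupport t u).card < (k + 2) ^ (2 * t + 1) := by
  rw [pow_succ']
  exact card_insert_biUnion_lt (G.left_regular u).le (by positivity)
    (G.card_checkMsgSupport_lt t) _

end OrderedRegularBipartiteGraph

/-! ### Expectations under a product weight -/

/-- Exchange the coordinates outside `A` of two points of a product. -/
def exchangeCompl {W Ω : Type*} [DecidableEq W] (A : Finset W) (x : (W → Ω) × (W → Ω)) : (W → Ω) × (W → Ω) :=
  (fun w => if w ∈ A then x.1 w else x.2 w, fun w => if w ∈ A then x.2 w else x.1 w)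

theorem exchangeCompl_involutive {W Ω : Type*} [DecidableEq W] (A : Finset W) :
    Function.Involutive (exchangeCompl (Ω := Ω) A) := by
  rintro ⟨x, y⟩
  simp only [exchangeCompl, Prod.mk.injEq]
  constructor <;> funext w <;> split_ifs <;> rfl

theorem dependsOn_prod {W Ω E : Type*} [DecidableEq W] {M : E → (W → Ω) → ℝ}
    {A : E → Finset W} (s : Finset E) (hM : ∀ e ∈ s, DependsOn (M e) (A e : Set W)) :
    DependsOn (fun ω => ∏ e ∈ s, M e ω) (s.biUnion A : Set W) := fun _ _ h =>
  Finset.prod_congr rfl fun e he => hM e he fun w hw => h w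
    (Finset.mem_coe.2 (Finset.mem_biUnion.2 ⟨e, he, Finset.mem_coe.1 hw⟩))

/-- The expectation of `F` when the coordinates of `ω : W → Ω` are independent and each of them has
the weight function `p`. -/
def prodExpect {W Ω : Type*} [Fintype W] [DecidableEq W] [Fintype Ω] (p : Ω → ℝ)
    (F : (W → Ω) → ℝ) : ℝ :=
  ∑ ω : W → Ω, (∏ w, p (ω w)) * F ω

section prodExpect

variable {W Ω : Type*} [Fintype W] [DecidableEq W] [Fintype Ω] {p : Ω → ℝ}

theorem prodExpect_prod (f : W → Ω → ℝ) :
    prodExpect p (fun ω => ∏ w, f w (ω w)) = ∏ w, ∑ o, p o * f w o := by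
  simp_rw [prodExpect, ← Finset.prod_mul_distrib]
  rw [Finset.prod_univ_sum, Fintype.piFinset_univ]

theorem prodExpect_apply (hp : ∑ o, p o = 1) (v : W) (f : Ω → ℝ) :
    prodExpect p (fun ω => f (ω v)) = ∑ o, p o * f o := by
  have h := prodExpect_prod (p := p) (fun w o => if w = v then f o else 1)
  have h1 : ∀ ω : W → Ω, (∏ w, if w = v then f (ω w) else 1) = f (ω v) := fun ω => by simp
  simp_rw [h1] at h
  rw [h, Finset.prod_eq_single v (fun w _ hw => by simp [hw, hp]) (by simp)]
  simp

theorem prodExpect_const (hp : ∑ o, p o = 1) (c : ℝ) :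
    prodExpect p (fun _ : W → Ω => c) = c := by
  have h := prodExpect_prod (W := W) (p := p) (fun _ _ => 1)
  simp only [Finset.prod_const_one, mul_one, hp] at h
  rw [prodExpect] at h ⊢
  rw [← Finset.sum_mul]
  simp only [mul_one] at h
  rw [h, one_mul]

theorem prodExpect_sum {ι : Type*} (s : Finset ι) (F : ι → (W → Ω) → ℝ) :
    prodExpect p (fun ω => ∑ i ∈ s, F i ω) = ∑ i ∈ s, prodExpect p (F i) := by
  simp_rw [prodExpect, Finset.mul_sum]
  exact Finset.sum_comm

theorem prodExpect_one_sub (hp : ∑ o, p o = 1) (F : (W → Ω) → ℝ) :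
    prodExpect p (fun ω => 1 - F ω) = 1 - prodExpect p F := by
  have h := prodExpect_const (W := W) hp 1
  simp only [prodExpect, mul_sub, Finset.sum_sub_distrib] at h ⊢
  rw [h]

/-- Write both sides as sums over pairs of outcomes. Exchanging the coordinates outside `A`
preserves the weight of a pair and leaves `F` of the first outcome unchanged, while `H` of the first
outcome becomes `H` of the second. -/
theorem prodExpect_mul (hp : ∑ o, p o = 1) {A B : Finset W} (hAB : Disjoint A B)
    {F H : (W → Ω) → ℝ} (hF : DependsOn F (A : Set W)) (hH : DependsOn H (B : Set W)) :
    prodExpect p (fun ω => F ω * H ω) = prodExpect p F * prodExpect p H := by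
  have hone : ∑ ω : W → Ω, ∏ w, p (ω w) = 1 := by
    have := prodExpect_const (W := W) hp 1
    simpa [prodExpect] using this
  have h1 : prodExpect p F * prodExpect p H = ∑ x : (W → Ω) × (W → Ω),
      ((∏ w, p (x.1 w)) * F x.1) * ((∏ w, p (x.2 w)) * H x.2) := by
    rw [prodExpect, prodExpect, Finset.sum_mul_sum, Fintype.sum_prod_type]
  have h2 : prodExpect p (fun ω => F ω * H ω) = ∑ x : (W → Ω) × (W → Ω),
      ((∏ w, p (x.1 w)) * (F x.1 * H x.1)) * (∏ w, p (x.2 w)) := by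
    rw [Fintype.sum_prod_type, ← Finset.sum_mul_sum Finset.univ Finset.univ
      (fun x : W → Ω => (∏ w, p (x w)) * (F x * H x)) (fun y : W → Ω => ∏ w, p (y w)), hone, mul_one,
      prodExpect]
  rw [h1, h2, ← Equiv.sum_comp (exchangeCompl_involutive (Ω := Ω) A).toPerm]
  refine Finset.sum_congr rfl fun x _ => ?_
  have hF' : F (exchangeCompl A x).1 = F x.1 := hF fun w hw => by
    simp [exchangeCompl, Finset.mem_coe.1 hw]
  have hH' : H (exchangeCompl A x).1 = H x.2 := hH fun w hw => by
    simp [exchangeCompl, Finset.disjoint_right.1 hAB (Finset.mem_coe.1 hw)]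
  have hw : (∏ w, p ((exchangeCompl A x).1 w)) * (∏ w, p ((exchangeCompl A x).2 w)) =
      (∏ w, p (x.1 w)) * (∏ w, p (x.2 w)) := by
    rw [← Finset.prod_mul_distrib, ← Finset.prod_mul_distrib]
    refine Finset.prod_congr rfl fun w _ => ?_
    simp only [exchangeCompl]
    split_ifs
    · rfl
    · ring
  change ((∏ w, p ((exchangeCompl A x).1 w)) * (F (exchangeCompl A x).1 *
    H (exchangeCompl A x).1)) * (∏ w, p ((exchangeCompl A x).2 w)) = _
  rw [hF', hH']
  linear_combination (F x.1 * H x.2) * hw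

theorem prodExpect_prod_of_disjoint (hp : ∑ o, p o = 1) {E : Type*} [DecidableEq E]
    {M : E → (W → Ω) → ℝ} {A : E → Finset W} (s : Finset E)
    (hM : ∀ e ∈ s, DependsOn (M e) (A e : Set W))
    (hA : ∀ e ∈ s, ∀ e' ∈ s, e ≠ e' → Disjoint (A e) (A e')) :
    prodExpect p (fun ω => ∏ e ∈ s, M e ω) = ∏ e ∈ s, prodExpect p (M e) := by
  induction s using Finset.induction_on with
  | empty => simpa using prodExpect_const hp 1
  | insert e s he ih =>
    simp only [Finset.prod_insert he]
    rw [prodExpect_mul hp _ (hM e (Finset.mem_insert_self e s))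
      (dependsOn_prod s fun e' h => hM e' (Finset.mem_insert_of_mem h)),
      ih (fun e' h => hM e' (Finset.mem_insert_of_mem h)) fun e₁ h₁ e₂ h₂ =>
        hA e₁ (Finset.mem_insert_of_mem h₁) e₂ (Finset.mem_insert_of_mem h₂)]
    rw [Finset.disjoint_biUnion_right]
    exact fun e' h => hA e (Finset.mem_insert_self e s) e' (Finset.mem_insert_of_mem h)
      fun hee => he (hee ▸ h)

/-- The expectation of a product of independent factors with the same mean, where the choice of the
factors depends on one further coordinate `v`. -/
theorem prodExpect_vertex [DecidableEq Ω] (hp : ∑ o, p o = 1) {E : Type*} [DecidableEq E] (v : W)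
    (r : Ω → ℝ) (N : Ω → Finset E) (T : Finset E) (hN : ∀ o, N o ⊆ T)
    {M : E → (W → Ω) → ℝ} {A : E → Finset W} {c : ℝ}
    (hM : ∀ e ∈ T, DependsOn (M e) (A e : Set W))
    (hA : ∀ e ∈ T, ∀ e' ∈ T, e ≠ e' → Disjoint (A e) (A e'))
    (hv : ∀ e ∈ T, v ∉ A e) (hc : ∀ e ∈ T, prodExpect p (M e) = c) :
    prodExpect p (fun ω => r (ω v) * ∏ e ∈ N (ω v), M e ω) =
      ∑ o, p o * (r o * c ^ (N o).card) := by
  -- Splitting by the value at `v` makes the index set of the product deterministic, so that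
  -- independence applies to each term.
  have h1 : ∀ ω : W → Ω, r (ω v) * ∏ e ∈ N (ω v), M e ω =
      ∑ o, (if ω v = o then r o else 0) * ∏ e ∈ N o, M e ω := fun ω => by
    rw [Finset.sum_eq_single (ω v) (fun o _ ho => by simp [ho.symm]) (by simp)]
    simp
  simp_rw [h1]
  rw [prodExpect_sum]
  refine Finset.sum_congr rfl fun o _ => ?_
  rw [prodExpect_mul (A := {v}) hp _ _ (dependsOn_prod (N o) fun e he => hM e (hN o he)),
    prodExpect_prod_of_disjoint hp (N o) (fun e he => hM e (hN o he))
      (fun e he e' he' => hA e (hN o he) e' (hN o he')),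
    Finset.prod_congr rfl (fun e he => hc e (hN o he)), Finset.prod_const,
    prodExpect_apply hp v (fun o' => if o' = o then r o else 0)]
  · simp [mul_assoc]
  · rw [Finset.disjoint_biUnion_right]
    exact fun e he => Finset.disjoint_singleton_left.2 (hv e (hN o he))
  · intro x y h
    simp only [h v (by simp)]

end prodExpect

/-! ### Edge ranks and the nodes of a split vertex -/

theorem edgeRank_lt_edgeRank {M n₀ : ℕ} (f : Fin M → Fin n₀) {e e' : Fin M} (h : e < e')
    (hf : f e = f e') : edgeRank f e < edgeRank f e' := by
  refine Finset.card_lt_card ⟨fun x hx => ?_, fun hs => ?_⟩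
  · simp only [Finset.mem_filter, Finset.mem_univ, true_and] at hx ⊢
    exact ⟨hx.1.trans h, hx.2.trans hf⟩
  · have he : e ∈ Finset.univ.filter fun e' => e' < e ∧ f e' = f e := hs (by simp [h, hf])
    simp at he

theorem edgeRank_injOn {M n₀ : ℕ} (f : Fin M → Fin n₀) (u : Fin n₀) :
    Set.InjOn (edgeRank f) {e | f e = u} := by
  intro e he e' he' h
  rcases lt_trichotomy e e' with hlt | heq | hlt
  · exact absurd h (edgeRank_lt_edgeRank f hlt (he.trans he'.symm)).ne
  · exact heq
  · exact absurd h (edgeRank_lt_edgeRank f hlt (he'.trans he.symm)).ne'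

theorem image_edgeRank {M n₀ k : ℕ} (f : Fin M → Fin n₀)
    (hf : ∀ u, (Finset.univ.filter fun e => f e = u).card = k) (u : Fin n₀) :
    (Finset.univ.filter fun e => f e = u).image (edgeRank f) = Finset.range k := by
  refine Finset.eq_of_subset_of_card_le (fun r hr => ?_) ?_
  · obtain ⟨e, -, rfl⟩ := Finset.mem_image.1 hr
    exact Finset.mem_range.2 (edgeRank_lt f hf e)
  · rw [Finset.card_image_of_injOn (by simpa using edgeRank_injOn f u), hf, Finset.card_range]

/-- The edges at `u` that go to the `j`-th new node when `u` is split into nodes of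
degree `d`. -/
def nodeEdges {M n₀ : ℕ} (f : Fin M → Fin n₀) (d : ℕ) (u : Fin n₀) (j : ℕ) : Finset (Fin M) :=
  Finset.univ.filter fun e => f e = u ∧ edgeRank f e / d = j

/-- The rank numbers the edges at `u` bijectively by 0, …, k - 1, and the `j`-th node receives the
block of ranks from dj to dj + d - 1. This block lies below k because d divides k. -/
theorem card_nodeEdges {M n₀ k : ℕ} (f : Fin M → Fin n₀)
    (hf : ∀ u, (Finset.univ.filter fun e => f e = u).card = k) {d : ℕ} (hd : 0 < d) (hdk : d ∣ k)
    (u : Fin n₀) {j : ℕ} (hj : j < k / d) : (nodeEdges f d u j).card = d := by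
  have h1 : (nodeEdges f d u j).image (edgeRank f) = Finset.Ico (d * j) (d * j + d) := by
    have hk : d * j + d ≤ k := by
      obtain ⟨c, rfl⟩ := hdk
      rw [Nat.mul_div_cancel_left _ hd] at hj
      nlinarith
    ext r
    simp only [nodeEdges, Finset.mem_image, Finset.mem_filter, Finset.mem_univ, true_and,
      Finset.mem_Ico]
    constructor
    · rintro ⟨e, ⟨-, he⟩, rfl⟩
      rw [Nat.div_eq_iff hd] at he
      have := mul_comm j d
      constructor <;> lia
    · rintro ⟨h1, h2⟩
      have hr : r ∈ (Finset.univ.filter fun e => f e = u).image (edgeRank f) := by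
        rw [image_edgeRank f hf]
        exact Finset.mem_range.2 (by lia)
      obtain ⟨e, he, rfl⟩ := Finset.mem_image.1 hr
      refine ⟨e, ⟨by simpa using he, ?_⟩, rfl⟩
      exact Nat.div_eq_of_lt_le (by linarith) (by linarith)
  rw [← Finset.card_image_of_injOn (f := edgeRank f), h1, Nat.card_Ico]
  · lia
  · exact (edgeRank_injOn f u).mono fun e he => by
      simp only [nodeEdges, Finset.coe_filter, Finset.mem_univ, true_and] at he
      exact he.1

/-- The other edges of the new node to which the edge `e` goes. -/
def siblingEdges {M n₀ : ℕ} (f : Fin M → Fin n₀) (d : ℕ) (e : Fin M) : Finset (Fin M) :=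
  (nodeEdges f d (f e) (edgeRank f e / d)).erase e

theorem mem_siblingEdges {M n₀ : ℕ} (f : Fin M → Fin n₀) (d : ℕ) (e e' : Fin M) :
    e' ∈ siblingEdges f d e ↔ e' ≠ e ∧ f e' = f e ∧ edgeRank f e' / d = edgeRank f e / d := by
  simp [siblingEdges, nodeEdges]

theorem card_siblingEdges {M n₀ k : ℕ} (f : Fin M → Fin n₀)
    (hf : ∀ u, (Finset.univ.filter fun e => f e = u).card = k) {d : ℕ} (hd : 0 < d) (hdk : d ∣ k)
    (e : Fin M) : (siblingEdges f d e).card = d - 1 := by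
  rw [siblingEdges, Finset.card_erase_of_mem (by simp [nodeEdges]),
    card_nodeEdges f hf hd hdk _ (Nat.div_lt_div_of_lt_of_dvd hdk (edgeRank_lt f hf e))]

/-! ### Weights of slots and erasure bits -/

/-- The weight function of a bit that is `true` with probability `ε`. -/
def bitWeight (ε : ℝ) (b : Bool) : ℝ := if b then ε else 1 - ε

theorem sum_bitWeight (ε : ℝ) : ∑ b, bitWeight ε b = 1 := by simp [bitWeight]

/-- The weight function of a pair of a uniform slot and independent erasure bits. -/
noncomputable def slotWeight {n₀ k : ℕ} (ε : ℝ) (o : Fin n₀ × (Fin k → Bool)) : ℝ :=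
  (n₀ : ℝ)⁻¹ * ∏ j, bitWeight ε (o.2 j)

theorem sum_slotWeight_mul {n₀ k : ℕ} (ε : ℝ) (g : Fin n₀ → ℝ) :
    ∑ o : Fin n₀ × (Fin k → Bool), slotWeight ε o * g o.1 = (∑ s, g s) / n₀ := by
  rw [Fintype.sum_prod_type, Finset.sum_div]
  refine Finset.sum_congr rfl fun s _ => ?_
  have h := prodExpect_const (W := Fin k) (sum_bitWeight ε) (g s / n₀)
  rw [← h, prodExpect]
  exact Finset.sum_congr rfl fun b _ => by simp only [slotWeight]; ring

theorem sum_slotWeight_bit_mul {n₀ k : ℕ} (ε : ℝ) (j : Fin n₀ → Fin k) (g : Fin n₀ → ℝ) :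
    ∑ o : Fin n₀ × (Fin k → Bool), slotWeight ε o * ((if o.2 (j o.1) then 1 else 0) * g o.1) =
      ε * ((∑ s, g s) / n₀) := by
  rw [Fintype.sum_prod_type, Finset.sum_div, Finset.mul_sum]
  refine Finset.sum_congr rfl fun s _ => ?_
  have h := prodExpect_apply (W := Fin k) (sum_bitWeight ε) (j s)
    (fun b => if b then g s / n₀ else 0)
  rw [show ∑ b, bitWeight ε b * (if b then g s / n₀ else 0) = ε * (g s / n₀) by
    simp [bitWeight]] at h
  rw [← h, prodExpect]
  exact Finset.sum_congr rfl fun b _ => by simp only [slotWeight]; split_ifs <;> ring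

theorem sum_slotWeight {n₀ k : ℕ} (hn : n₀ ≠ 0) (ε : ℝ) :
    ∑ o : Fin n₀ × (Fin k → Bool), slotWeight ε o = 1 := by
  have h := sum_slotWeight_mul (k := k) (n₀ := n₀) ε (fun _ => 1)
  simpa [hn] using h

/-! ### Density evolution for independent slots -/

namespace OrderedRegularBipartiteGraph

variable {n₀ k : ℕ} (G : OrderedRegularBipartiteGraph n₀ k) (dl dr : Fin n₀ → ℕ)

/-- The position of the variable node of the edge `e` among the nodes into which the left end of `e`
is split. -/
def leftNodeIndex (d : ℕ) (e : Fin (n₀ * k)) : Fin k :=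
  ⟨edgeRank G.left e / d, (Nat.div_le_self _ _).trans_lt (edgeRank_lt G.left G.left_regular e)⟩

/-- Erasure indicators of the check-to-variable messages. The outcome `ω` gives a slot to each vertex,
and erasure bits to the nodes into which it is split. -/
def checkMsg (ω : Fin n₀ ⊕ Fin n₀ → Fin n₀ × (Fin k → Bool)) : ℕ → Fin (n₀ * k) → ℝ
  | 0, _ => 1
  | t + 1, e => 1 - 1 * ∏ e' ∈ siblingEdges G.right (dr (ω (Sum.inr (G.right e))).1) e,
      (1 - (if (ω (Sum.inl (G.left e'))).2
            (G.leftNodeIndex (dl (ω (Sum.inl (G.left e'))).1) e') then 1 else 0) *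
        ∏ e'' ∈ siblingEdges G.left (dl (ω (Sum.inl (G.left e'))).1) e', checkMsg ω t e'')

/-- Erasure indicators of the variable-to-check messages. -/
def varMsg (ω : Fin n₀ ⊕ Fin n₀ → Fin n₀ × (Fin k → Bool)) (t : ℕ) (e : Fin (n₀ * k)) : ℝ :=
  (if (ω (Sum.inl (G.left e))).2 (G.leftNodeIndex (dl (ω (Sum.inl (G.left e))).1) e)
    then 1 else 0) *
  ∏ e' ∈ siblingEdges G.left (dl (ω (Sum.inl (G.left e))).1) e, G.checkMsg dl dr ω t e'

theorem checkMsg_succ (ω : Fin n₀ ⊕ Fin n₀ → Fin n₀ × (Fin k → Bool)) (t : ℕ)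
    (e : Fin (n₀ * k)) : G.checkMsg dl dr ω (t + 1) e =
      1 - 1 * ∏ e' ∈ siblingEdges G.right (dr (ω (Sum.inr (G.right e))).1) e,
        (1 - G.varMsg dl dr ω t e') := rfl

/-- The number of erased nodes among those into which the left vertex `u` is split. -/
def rootMsg (ω : Fin n₀ ⊕ Fin n₀ → Fin n₀ × (Fin k → Bool)) (t : ℕ) (u : Fin n₀) : ℝ :=
  ∑ j : Fin k, (if (ω (Sum.inl u)).2 j then 1 else 0) *
    (if (j : ℕ) < k / dl (ω (Sum.inl u)).1 then 1 else 0) *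
    ∏ e ∈ nodeEdges G.left (dl (ω (Sum.inl u)).1) u j, G.checkMsg dl dr ω t e

theorem checkMsgSupport_subset_varMsgSupport {t d : ℕ} {e e' : Fin (n₀ * k)}
    (h : e' ∈ siblingEdges G.left d e) : G.checkMsgSupport t e' ⊆ G.varMsgSupport t e := by
  rw [mem_siblingEdges] at h
  exact (Finset.subset_biUnion_of_mem (G.checkMsgSupport t)
    (Finset.mem_filter.2 ⟨Finset.mem_univ _, h.1, h.2.1⟩)).trans (Finset.subset_insert _ _)

theorem dependsOn_varMsg {t : ℕ}
    (ih : ∀ e, DependsOn (fun ω => G.checkMsg dl dr ω t e) (G.checkMsgSupport t e : Set _))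
    (e : Fin (n₀ * k)) :
    DependsOn (fun ω => G.varMsg dl dr ω t e) (G.varMsgSupport t e : Set _) := by
  intro ω ω' h
  have hv : ω (Sum.inl (G.left e)) = ω' (Sum.inl (G.left e)) :=
    h _ (by simp [varMsgSupport])
  simp only [varMsg, hv]
  refine congrArg _ (Finset.prod_congr rfl fun e' he' => ih e' fun w hw => h w ?_)
  exact Finset.mem_coe.2 (G.checkMsgSupport_subset_varMsgSupport he' hw)

theorem dependsOn_checkMsg (t : ℕ) (e : Fin (n₀ * k)) :
    DependsOn (fun ω => G.checkMsg dl dr ω t e) (G.checkMsgSupport t e : Set _) := by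
  induction t generalizing e with
  | zero => intro _ _ _; rfl
  | succ t ih =>
    intro ω ω' h
    have hv : ω (Sum.inr (G.right e)) = ω' (Sum.inr (G.right e)) :=
      h _ (by simp [checkMsgSupport_succ])
    simp only [checkMsg_succ, hv]
    refine congrArg (fun r : ℝ => 1 - 1 * r) (Finset.prod_congr rfl fun e' he' =>
      congrArg (fun r : ℝ => 1 - r) (G.dependsOn_varMsg dl dr ih e' fun w hw => h w ?_))
    rw [mem_siblingEdges] at he'
    rw [checkMsgSupport_succ]
    exact Finset.mem_coe.2 (Finset.mem_insert_of_mem (Finset.mem_biUnion.2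
      ⟨e', Finset.mem_filter.2 ⟨Finset.mem_univ _, he'.1, he'.2.1⟩, hw⟩))

theorem dependsOn_rootMsg (t : ℕ) (u : Fin n₀) :
    DependsOn (fun ω => G.rootMsg dl dr ω t u) (G.rootSupport t u : Set _) := by
  intro ω ω' h
  have hv : ω (Sum.inl u) = ω' (Sum.inl u) := h _ (by simp [rootSupport])
  simp only [rootMsg, hv]
  refine Finset.sum_congr rfl fun j _ => congrArg _ (Finset.prod_congr rfl fun e he =>
    G.dependsOn_checkMsg dl dr t e fun w hw => h w ?_)
  simp only [nodeEdges, Finset.mem_filter, Finset.mem_univ, true_and] at he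
  exact Finset.mem_coe.2 (Finset.mem_insert_of_mem (Finset.mem_biUnion.2
    ⟨e, by simpa using he.1, hw⟩))

variable {dl dr}

theorem prodExpect_varMsg (hn : n₀ ≠ 0) (hdl : ∀ s, 0 < dl s ∧ dl s ∣ k) (ε : ℝ) {t : ℕ}
    (hg : ((4 * t + 2 : ℕ) : ℕ∞) ≤ G.toSimpleGraph.egirth) {c : ℝ}
    (hc : ∀ e, prodExpect (slotWeight ε) (fun ω => G.checkMsg dl dr ω t e) = c)
    (e : Fin (n₀ * k)) : prodExpect (slotWeight ε) (fun ω => G.varMsg dl dr ω t e) =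
      ε * ((∑ s, c ^ (dl s - 1)) / n₀) := by
  have h := prodExpect_vertex (sum_slotWeight hn ε) (Sum.inl (G.left e) : Fin n₀ ⊕ Fin n₀)
    (fun o => if o.2 (G.leftNodeIndex (dl o.1) e) then 1 else 0)
    (fun o => siblingEdges G.left (dl o.1) e)
    (Finset.univ.filter fun e' => e' ≠ e ∧ G.left e' = G.left e)
    (fun o e' he' => by
      rw [mem_siblingEdges] at he'
      simpa using ⟨he'.1, he'.2.1⟩)
    (M := fun e' ω => G.checkMsg dl dr ω t e') (A := G.checkMsgSupport t) (c := c)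
    (fun e' _ => G.dependsOn_checkMsg dl dr t e')
    (fun e₁ h₁ e₂ h₂ hne => G.disjoint_checkMsgSupport hg hne (by simp_all))
    (fun e' he' => by
      simp only [Finset.mem_filter, Finset.mem_univ, true_and] at he'
      rw [← he'.2]
      exact G.left_notMem_checkMsgSupport hg e')
    (fun e' _ => hc e')
  refine Eq.trans h ?_
  rw [← sum_slotWeight_bit_mul ε (fun s => G.leftNodeIndex (dl s) e)]
  exact Finset.sum_congr rfl fun o _ => by
    rw [card_siblingEdges G.left G.left_regular (hdl o.1).1 (hdl o.1).2]

/-- Given the slot of the check vertex, the incoming messages are independent, since their supports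
are disjoint and avoid that vertex. The sequence `z` is kept abstract, as a recursion over slots,
and is later identified with density evolution. -/
theorem prodExpect_checkMsg (hn : n₀ ≠ 0) (hdl : ∀ s, 0 < dl s ∧ dl s ∣ k)
    (hdr : ∀ s, 0 < dr s ∧ dr s ∣ k) (ε : ℝ) {z : ℕ → ℝ} (hz0 : z 0 = 1)
    (hz : ∀ t, z (t + 1) =
      1 - (∑ s, (1 - ε * ((∑ s, z t ^ (dl s - 1)) / n₀)) ^ (dr s - 1)) / n₀) (t : ℕ)
    (hg : ((4 * t + 2 : ℕ) : ℕ∞) ≤ G.toSimpleGraph.egirth)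
    (e : Fin (n₀ * k)) :
    prodExpect (slotWeight ε) (fun ω => G.checkMsg dl dr ω t e) = z t := by
  induction t generalizing e with
  | zero => rw [hz0]; exact prodExpect_const (sum_slotWeight hn ε) 1
  | succ t ih =>
    have hg' : ((4 * t + 2 : ℕ) : ℕ∞) ≤ G.toSimpleGraph.egirth :=
      le_trans (by norm_cast; lia) hg
    have hx := G.prodExpect_varMsg hn hdl ε hg' (ih hg')
    have h := prodExpect_vertex (sum_slotWeight hn ε) (Sum.inr (G.right e) : Fin n₀ ⊕ Fin n₀)
      (fun _ => 1)
      (fun o => siblingEdges G.right (dr o.1) e)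
      (Finset.univ.filter fun e' => e' ≠ e ∧ G.right e' = G.right e)
      (fun o e' he' => by
        rw [mem_siblingEdges] at he'
        simpa using ⟨he'.1, he'.2.1⟩)
      (M := fun e' ω => 1 - G.varMsg dl dr ω t e') (A := G.varMsgSupport t)
      (fun e' _ ω ω' h => congrArg (fun r : ℝ => 1 - r)
        (G.dependsOn_varMsg dl dr (G.dependsOn_checkMsg dl dr t) e' h))
      (fun e₁ h₁ e₂ h₂ hne => G.disjoint_varMsgSupport hg hne (by simp_all))
      (fun e' he' => by
        simp only [Finset.mem_filter, Finset.mem_univ, true_and] at he'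
        rw [← he'.2]
        exact G.right_notMem_varMsgSupport hg e')
      (fun e' _ => (prodExpect_one_sub (sum_slotWeight hn ε) _).trans
        (congrArg (fun r : ℝ => 1 - r) (hx e')))
    simp only [checkMsg_succ]
    -- The factor `1 *` in `checkMsg` is the weight `r` of `prodExpect_vertex`, so `h` matches as it
    -- stands.
    rw [prodExpect_one_sub (sum_slotWeight hn ε), h, hz,
      ← sum_slotWeight_mul (k := k) ε fun s =>
        (1 - ε * ((∑ s, z t ^ (dl s - 1)) / n₀)) ^ (dr s - 1)]
    refine congrArg (fun r : ℝ => 1 - r) (Finset.sum_congr rfl fun o _ => ?_)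
    rw [card_siblingEdges G.right G.right_regular (hdr o.1).1 (hdr o.1).2, one_mul]

theorem prodExpect_rootMsg (hn : n₀ ≠ 0) (hdl : ∀ s, 0 < dl s ∧ dl s ∣ k)
    (hdr : ∀ s, 0 < dr s ∧ dr s ∣ k) (ε : ℝ) {z : ℕ → ℝ} (hz0 : z 0 = 1)
    (hz : ∀ t, z (t + 1) =
      1 - (∑ s, (1 - ε * ((∑ s, z t ^ (dl s - 1)) / n₀)) ^ (dr s - 1)) / n₀) (t : ℕ)
    (hg : ((4 * t + 2 : ℕ) : ℕ∞) ≤ G.toSimpleGraph.egirth) (u : Fin n₀) :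
    prodExpect (slotWeight ε) (fun ω => G.rootMsg dl dr ω t u) =
      ε * ((∑ s, ((k / dl s : ℕ) : ℝ) * z t ^ dl s) / n₀) := by
  simp only [rootMsg]
  rw [prodExpect_sum]
  have h : ∀ j : Fin k, prodExpect (slotWeight ε) (fun ω : Fin n₀ ⊕ Fin n₀ → _ =>
      (if (ω (Sum.inl u)).2 j then 1 else 0) *
        (if (j : ℕ) < k / dl (ω (Sum.inl u)).1 then 1 else 0) *
        ∏ e ∈ nodeEdges G.left (dl (ω (Sum.inl u)).1) u j, G.checkMsg dl dr ω t e) =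
      ε * ((∑ s, if (j : ℕ) < k / dl s then z t ^ dl s else 0) / n₀) := fun j => by
    have h := prodExpect_vertex (sum_slotWeight hn ε) (Sum.inl u : Fin n₀ ⊕ Fin n₀)
      (fun o => (if o.2 j then 1 else 0) * (if (j : ℕ) < k / dl o.1 then 1 else 0))
      (fun o => nodeEdges G.left (dl o.1) u j)
      (Finset.univ.filter fun e => G.left e = u)
      (fun o e he => by
        simp only [nodeEdges, Finset.mem_filter] at he
        simpa using he.2.1)
      (M := fun e ω => G.checkMsg dl dr ω t e) (A := G.checkMsgSupport t) (c := z t)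
      (fun e _ => G.dependsOn_checkMsg dl dr t e)
      (fun e₁ h₁ e₂ h₂ hne => G.disjoint_checkMsgSupport hg hne (by simp_all))
      (fun e he => by
        simp only [Finset.mem_filter, Finset.mem_univ, true_and] at he
        rw [← he]
        exact G.left_notMem_checkMsgSupport hg e)
      (fun e _ => G.prodExpect_checkMsg hn hdl hdr ε hz0 hz t hg e)
    refine Eq.trans h ?_
    rw [← sum_slotWeight_bit_mul ε (fun _ => j)]
    refine Finset.sum_congr rfl fun o _ => ?_
    split_ifs with h1 h2
    · rw [card_nodeEdges G.left G.left_regular (hdl o.1).1 (hdl o.1).2 u h2, one_mul]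
    all_goals simp
  -- After exchanging the sums, each slot `s` is counted once for each of the `k / dl s` indices `j`
  -- that are real nodes.
  rw [Finset.sum_congr rfl fun j _ => h j, ← Finset.mul_sum, ← Finset.sum_div,
    Finset.sum_comm]
  congr 2
  refine Finset.sum_congr rfl fun s _ => ?_
  rw [← Finset.sum_filter, Finset.sum_const, nsmul_eq_mul]
  congr 2
  rw [Fin.card_filter_val_lt]
  exact min_eq_right (Nat.div_le_self _ _)

end OrderedRegularBipartiteGraph

/-! ### Uniform permutations compared with uniform functions -/

open Finset in
theorem card_functions_eqOn {n : ℕ} (A : Finset (Fin n)) (f : Fin n → Fin n) :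
    (univ.filter fun h : Fin n → Fin n => ∀ a ∈ A, h a = f a).card = n ^ (n - A.card) := by
  have : (univ.filter fun h : Fin n → Fin n => ∀ a ∈ A, h a = f a) =
      Fintype.piFinset fun a => if a ∈ A then {f a} else univ := by
    ext h
    simp only [mem_filter, mem_univ, true_and, Fintype.mem_piFinset]
    refine forall_congr' fun a => ?_
    split_ifs with ha <;> simp [ha]
  rw [this, Fintype.card_piFinset]
  have h2 : ∀ a : Fin n, (if a ∈ A then {f a} else univ : Finset (Fin n)).card =
      if a ∈ Aᶜ then n else 1 := fun a => by
    by_cases ha : a ∈ A <;> simp [ha]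
  rw [prod_congr rfl fun a _ => h2 a, prod_ite_mem, univ_inter, prod_const, card_compl,
    Fintype.card_fin]

open Finset in
-- Translating by the inverse of one such permutation sends all of them injectively to permutations
-- that fix `A` pointwise. There may be none, whence only an inequality.
theorem card_perms_eqOn_le {n : ℕ} (A : Finset (Fin n)) (h : Fin n → Fin n) :
    (univ.filter fun σ : Equiv.Perm (Fin n) => ∀ a ∈ A, σ a = h a).card ≤
      (n - A.card).factorial := by
  rcases (univ.filter fun σ : Equiv.Perm (Fin n) => ∀ a ∈ A, σ a = h a).eq_empty_or_nonempty
    with he | ⟨σ₀, hσ₀⟩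
  · simp [he]
  · have h0 : ∀ a ∈ A, σ₀ a = h a := by simpa using hσ₀
    have hcard : Fintype.card {f : Equiv.Perm (Fin n) // ∀ a, ¬ a ∉ A → f a = a} =
        (n - A.card).factorial := by
      rw [← Fintype.card_congr (Equiv.Perm.subtypeEquivSubtypePerm fun a => a ∉ A),
        Fintype.card_perm]
      congr 1
      rw [Fintype.card_subtype_compl, Fintype.card_fin, Fintype.card_coe]
    rw [← hcard, Fintype.card_subtype]
    refine card_le_card_of_injOn (fun σ => σ₀⁻¹ * σ) (fun σ hσ => ?_)
      (fun σ _ σ' _ hss => mul_left_cancel hss)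
    have hσ' : ∀ a ∈ A, σ a = h a := by simpa using hσ
    rw [mem_coe, mem_filter]
    refine ⟨mem_univ _, fun a ha => ?_⟩
    rw [Equiv.Perm.mul_apply, hσ' a (not_not.1 ha), ← h0 a (not_not.1 ha)]
    exact σ₀.symm_apply_apply a

open Finset in
/-- Sampling without replacement, compared to sampling with replacement. -/
theorem sum_perm_mul_le {n : ℕ} (A : Finset (Fin n)) {F : (Fin n → Fin n) → ℝ}
    (hF0 : ∀ h, 0 ≤ F h) (hF : DependsOn F (A : Set (Fin n))) :
    (∑ σ : Equiv.Perm (Fin n), F σ) * (n : ℝ) ^ (n - A.card) ≤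
      (n - A.card).factorial * ∑ h : Fin n → Fin n, F h := by
  -- Double counting of pairs that agree on `A`: each permutation has n^(n - |A|) such functions, on
  -- all of which `F` takes the same value.
  have h1 : (∑ σ : Equiv.Perm (Fin n), F σ) * (n : ℝ) ^ (n - A.card) =
      ∑ σ : Equiv.Perm (Fin n), ∑ h : Fin n → Fin n, if ∀ a ∈ A, h a = σ a then F h else 0 := by
    rw [sum_mul]
    refine sum_congr rfl fun σ _ => ?_
    have hs : ∀ h ∈ univ.filter fun h : Fin n → Fin n => ∀ a ∈ A, h a = σ a, F h = F σ :=
      fun h hh => hF fun a ha => (mem_filter.1 hh).2 a (mem_coe.1 ha)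
    rw [← sum_filter, sum_congr rfl hs, sum_const, card_functions_eqOn, nsmul_eq_mul, mul_comm]
    push_cast
    ring
  rw [h1, sum_comm, mul_sum]
  refine sum_le_sum fun h _ => ?_
  rw [← sum_filter, sum_const, nsmul_eq_mul]
  refine mul_le_mul_of_nonneg_right ?_ (hF0 h)
  simp_rw [eq_comm (a := h _)]
  exact_mod_cast card_perms_eqOn_le A h

/-- The quotient n!/(n - m)! is at least (n - m)^m = n^m (1 - m/n)^m, and Bernoulli's inequality
bounds the last factor below by 1 - m²/n. -/
theorem pow_mul_factorial_sub_le {n m : ℕ} (hm : m ≤ n) :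
    (1 - (m : ℝ) ^ 2 / n) * ((n : ℝ) ^ m * (n - m).factorial) ≤ n.factorial := by
  rcases Nat.eq_zero_or_pos n with rfl | hn
  · obtain rfl : m = 0 := by lia
    simp
  have hn' : (0 : ℝ) < n := by exact_mod_cast hn
  have h1 : ((n - m : ℕ) : ℝ) ^ m ≤ n.descFactorial m := by
    exact_mod_cast le_trans (Nat.pow_le_pow_left (by lia) m) (Nat.pow_sub_le_descFactorial n m)
  have h2 : 1 - (m : ℝ) ^ 2 / n ≤ (1 + -((m : ℝ) / n)) ^ m := by
    refine le_trans (le_of_eq ?_) (one_add_mul_le_pow (a := -((m : ℝ) / n)) ?_ m)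
    · ring
    · have : (m : ℝ) / n ≤ 1 := by
        rw [div_le_one hn']
        exact_mod_cast hm
      linarith
  have h3 : (1 + -((m : ℝ) / n)) ^ m * (n : ℝ) ^ m = ((n - m : ℕ) : ℝ) ^ m := by
    rw [← mul_pow, Nat.cast_sub hm]
    congr 1
    field_simp
    ring
  have h4 : (n.factorial : ℝ) = (n - m).factorial * n.descFactorial m := by
    exact_mod_cast (Nat.factorial_mul_descFactorial hm).symm
  rw [h4]
  calc (1 - (m : ℝ) ^ 2 / n) * ((n : ℝ) ^ m * (n - m).factorial)
      ≤ (1 + -((m : ℝ) / n)) ^ m * ((n : ℝ) ^ m * (n - m).factorial) :=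
        mul_le_mul_of_nonneg_right h2 (by positivity)
    _ = (n - m).factorial * ((n - m : ℕ) : ℝ) ^ m := by rw [← h3]; ring
    _ ≤ _ := mul_le_mul_of_nonneg_left h1 (by positivity)

theorem perm_average_le {n m : ℕ} (hmn : m ^ 2 < n) {A : Finset (Fin n)} (hA : A.card ≤ m)
    {F : (Fin n → Fin n) → ℝ} (hF0 : ∀ h, 0 ≤ F h) (hF : DependsOn F (A : Set (Fin n))) :
    (1 - (m : ℝ) ^ 2 / n) * ((∑ σ : Equiv.Perm (Fin n), F σ) / n.factorial) ≤
      (∑ h : Fin n → Fin n, F h) / (n : ℝ) ^ n := by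
  have hn : 0 < n := by lia
  have hn' : (0 : ℝ) < n := by exact_mod_cast hn
  set a := A.card with ha
  have han : a ≤ n := by
    have := Finset.card_le_univ A
    simpa using this
  set S := ∑ σ : Equiv.Perm (Fin n), F σ with hS
  set T := ∑ h : Fin n → Fin n, F h with hT
  have hS0 : 0 ≤ S := Finset.sum_nonneg fun σ _ => hF0 σ
  have h1 : S * (n : ℝ) ^ (n - a) ≤ (n - a).factorial * T := sum_perm_mul_le A hF0 hF
  have h2 := pow_mul_factorial_sub_le han
  have h3 : 1 - (m : ℝ) ^ 2 / n ≤ 1 - (a : ℝ) ^ 2 / n := by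
    have : (a : ℝ) ≤ m := by exact_mod_cast hA
    gcongr
  have hf : (0 : ℝ) < n.factorial := by exact_mod_cast n.factorial_pos
  have hf' : (0 : ℝ) < (n - a).factorial := by exact_mod_cast (n - a).factorial_pos
  have hc0 : 0 ≤ 1 - (m : ℝ) ^ 2 / n := by
    rw [sub_nonneg, div_le_one hn']
    exact_mod_cast hmn.le
  have hpow : (n : ℝ) ^ n = n ^ a * n ^ (n - a) := by rw [← pow_add]; congr 1; lia
  rw [mul_div_assoc', div_le_div_iff₀ hf (by positivity), hpow]
  calc (1 - (m : ℝ) ^ 2 / n) * S * ((n : ℝ) ^ a * n ^ (n - a))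
      = (1 - (m : ℝ) ^ 2 / n) * n ^ a * (S * (n : ℝ) ^ (n - a)) := by ring
    _ ≤ (1 - (m : ℝ) ^ 2 / n) * n ^ a * ((n - a).factorial * T) :=
        mul_le_mul_of_nonneg_left h1 (by positivity)
    _ = (1 - (m : ℝ) ^ 2 / n) * (n ^ a * (n - a).factorial) * T := by ring
    _ ≤ (1 - (a : ℝ) ^ 2 / n) * (n ^ a * (n - a).factorial) * T := by
        have : 0 ≤ T := Finset.sum_nonneg fun h _ => hF0 h
        gcongr
    _ ≤ n.factorial * T := by
        have : 0 ≤ T := Finset.sum_nonneg fun h _ => hF0 h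
        gcongr
    _ = T * n.factorial := mul_comm _ _

/-- The comparison for two independent permutations. -/
theorem two_perm_average_le {n m : ℕ} (hmn : m ^ 2 < n) {A B : Finset (Fin n)}
    (hA : A.card ≤ m) (hB : B.card ≤ m) {F : (Fin n → Fin n) → (Fin n → Fin n) → ℝ}
    (hF0 : ∀ g h, 0 ≤ F g h) (hFA : ∀ h, DependsOn (fun g => F g h) (A : Set (Fin n)))
    (hFB : ∀ g, DependsOn (F g) (B : Set (Fin n))) :
    (1 - 2 * (m : ℝ) ^ 2 / n) * ((∑ σ : Equiv.Perm (Fin n), ∑ π : Equiv.Perm (Fin n), F σ π) /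
        ((n.factorial : ℝ) * n.factorial)) ≤
      (∑ g : Fin n → Fin n, ∑ h : Fin n → Fin n, F g h) / ((n : ℝ) ^ n * (n : ℝ) ^ n) := by
  have hn' : (0 : ℝ) < n := by exact_mod_cast (by lia : 0 < n)
  set c := 1 - (m : ℝ) ^ 2 / n with hc
  have hc0 : 0 ≤ c := by
    rw [sub_nonneg, div_le_one hn']
    exact_mod_cast hmn.le
  set S := (∑ σ : Equiv.Perm (Fin n), ∑ π : Equiv.Perm (Fin n), F σ π) /
        ((n.factorial : ℝ) * n.factorial) with hS
  have hS0 : 0 ≤ S := div_nonneg (Finset.sum_nonneg fun σ _ => Finset.sum_nonneg fun π _ =>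
    hF0 σ π) (by positivity)
  have h1 : c * S ≤ (∑ σ : Equiv.Perm (Fin n), (∑ h : Fin n → Fin n, F σ h) / (n : ℝ) ^ n) /
      n.factorial := by
    rw [hS, ← div_div, Finset.sum_div, mul_div_assoc', Finset.mul_sum]
    refine div_le_div_of_nonneg_right (Finset.sum_le_sum fun σ _ => ?_) (by positivity)
    exact perm_average_le hmn hB (hF0 σ) (hFB σ)
  have h2 := perm_average_le hmn hA (F := fun g => (∑ h : Fin n → Fin n, F g h) / (n : ℝ) ^ n)
    (fun g => div_nonneg (Finset.sum_nonneg fun h _ => hF0 g h) (by positivity))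
    (fun g g' hgg => congrArg (· / (n : ℝ) ^ n) (Finset.sum_congr rfl fun h _ => hFA h hgg))
  -- One factor `c` is lost for each permutation; the square of m²/n is discarded.
  have h3 : (1 - 2 * (m : ℝ) ^ 2 / n) ≤ c * c := by
    have : (0 : ℝ) ≤ ((m : ℝ) ^ 2 / n) ^ 2 := by positivity
    rw [hc]
    nlinarith [mul_div_assoc 2 ((m : ℝ) ^ 2) (n : ℝ)]
  calc (1 - 2 * (m : ℝ) ^ 2 / n) * S ≤ c * c * S := mul_le_mul_of_nonneg_right h3 hS0
    _ = c * (c * S) := mul_assoc _ _ _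
    _ ≤ _ := mul_le_mul_of_nonneg_left h1 hc0
    _ ≤ _ := h2
    _ = _ := by rw [← Finset.sum_div, div_div]

/-! ### Erasures in the decoder -/

namespace TannerGraph

/-- Only the pattern of erasures enters, so neither the transmitted values nor the arbitrary choice
in `varRule` matters. -/
theorem varRule_eq_none_iff {E : Type*} (o : Option (ZMod 2)) (S : Finset E)
    (m : E → Option (ZMod 2)) : varRule o S m = none ↔ o = none ∧ ∀ e ∈ S, m e = none := by
  unfold varRule
  split_ifs with h
  · simp only [false_iff, not_and]
    obtain ⟨b, hb | ⟨e, he, hb⟩⟩ := h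
    · simp [hb]
    · intro _ h
      simp [h e he] at hb
  · simp only [true_iff]
    refine ⟨?_, fun e he => ?_⟩
    · rw [Option.eq_none_iff_forall_ne_some]
      exact fun b hb => h ⟨b, Or.inl hb⟩
    · rw [Option.eq_none_iff_forall_ne_some]
      exact fun b hb => h ⟨b, Or.inr ⟨e, he, hb⟩⟩

theorem chkRule_eq_none_iff {E : Type*} [Fintype E] (S : Finset E) (m : E → Option (ZMod 2)) :
    chkRule S m = none ↔ ∃ e ∈ S, m e = none := by
  unfold chkRule
  split_ifs with h
  · simp only [false_iff, not_exists, not_and]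
    exact h
  · simpa using h

theorem received_eq_none_iff {V : Type*} (x : V → ZMod 2) (S : Finset V) (v : V) :
    received x S v = none ↔ v ∈ S := by
  unfold received
  split_ifs with h <;> simp [h]

theorem code_card_pos {V C E : Type*} [Fintype V] [Fintype C] [Fintype E]
    (T : TannerGraph V C E) : 0 < T.code.card :=
  Finset.card_pos.2 ⟨0, by simp [code]⟩

end TannerGraph

/-! ### Erased sets as families of independent bits -/

theorem prod_ite_one_zero {E : Type*} (s : Finset E) (q : E → Prop) [DecidablePred q]
    [Decidable (∀ e ∈ s, q e)] :
    (∏ e ∈ s, if q e then (1 : ℝ) else 0) = if ∀ e ∈ s, q e then 1 else 0 := by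
  split_ifs with h
  · exact Finset.prod_eq_one fun e he => by simp [h e he]
  · push Not at h
    obtain ⟨e, he, hq⟩ := h
    exact Finset.prod_eq_zero he (by simp [hq])

theorem sum_powerset_eq_sum_bits {V : Type*} [Fintype V] [DecidableEq V] (ε : ℝ) (f : Finset V → ℝ) :
    ∑ S : Finset V, ε ^ S.card * (1 - ε) ^ (Fintype.card V - S.card) * f S =
      ∑ b : V → Bool, (∏ v, bitWeight ε (b v)) * f (Finset.univ.filter fun v => b v = true) := by
  refine (Finset.sum_bij' (fun (b : V → Bool) _ => Finset.univ.filter fun v => b v = true)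
    (fun (S : Finset V) _ v => decide (v ∈ S)) (by simp) (by simp) (by simp) (by simp) ?_).symm
  intro b _
  congr 1
  simp only [bitWeight]
  rw [Finset.prod_ite, Finset.prod_const, Finset.prod_const, Finset.filter_not,
    ← Finset.compl_eq_univ_sdiff, Finset.card_compl]

/-- The bits outside the range of `φ` have total weight 1. This allows every vertex, left or right,
to carry k bits regardless of how many variable nodes it is split into; the map in use is `nodeBit
σ`. -/
theorem sum_bits_comp_injective {V U : Type*} [Fintype V] [DecidableEq V] [Fintype U]
    [DecidableEq U] (ε : ℝ) {φ : V → U} (hφ : Function.Injective φ) (f : (V → Bool) → ℝ) :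
    ∑ b : U → Bool, (∏ u, bitWeight ε (b u)) * f (fun v => b (φ v)) =
      ∑ b : V → Bool, (∏ v, bitWeight ε (b v)) * f b := by
  classical
  let e : V ⊕ ((Set.range φ)ᶜ : Set U) ≃ U :=
    (Equiv.sumCongr (Equiv.ofInjective φ hφ) (Equiv.refl _)).trans (Equiv.Set.sumCompl _)
  have he : ∀ v, e (Sum.inl v) = φ v := fun v => by simp [e]
  rw [← Equiv.sum_comp ((Equiv.sumArrowEquivProdArrow V ((Set.range φ)ᶜ : Set U) Bool).symm.trans
    (Equiv.arrowCongr e (Equiv.refl Bool))), Fintype.sum_prod_type]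
  refine Finset.sum_congr rfl fun b _ => ?_
  have h1 := prodExpect_const (W := ((Set.range φ)ᶜ : Set U)) (sum_bitWeight ε)
    ((∏ v, bitWeight ε (b v)) * f b)
  rw [← h1, prodExpect]
  refine Finset.sum_congr rfl fun r _ => ?_
  have h2 : (fun v => ((Equiv.sumArrowEquivProdArrow V ((Set.range φ)ᶜ : Set U) Bool).symm.trans
    (Equiv.arrowCongr e (Equiv.refl Bool))) (b, r) (φ v)) = b := by
    funext v
    simp [← he, Equiv.sumArrowEquivProdArrow]
  rw [h2, ← Equiv.prod_comp e, Fintype.prod_sum_type]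
  simp [Equiv.sumArrowEquivProdArrow]
  ring

/-! ### The decoder on the split graph in terms of erasure indicators -/

theorem splitEnd_eq_mk_iff (d : DegreeDistribution) {n₀ M k : ℕ}
    (hk : ∀ j ∈ d.coeff.support, j ∣ k) (f : Fin M → Fin n₀)
    (hf : ∀ u, (Finset.univ.filter fun e => f e = u).card = k)
    (τ : Equiv.Perm (Fin n₀)) (e : Fin M) (v : d.SplitNode n₀ k) :
    splitEnd d hk f hf τ e = v ↔
      f e = τ v.1 ∧ edgeRank f e / d.slotDegree n₀ v.1 = (v.2 : ℕ) := by
  obtain ⟨s, j⟩ := v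
  rw [← Equiv.symm_apply_eq]
  constructor
  · rintro h
    rw [splitEnd, Sigma.mk.injEq] at h
    obtain ⟨rfl, h⟩ := h
    exact ⟨rfl, congrArg Fin.val (eq_of_heq h)⟩
  · rintro ⟨rfl, h⟩
    rw [splitEnd, Sigma.mk.injEq]
    exact ⟨rfl, heq_of_eq (Fin.ext h)⟩

theorem splitEnd_eq_splitEnd_iff (d : DegreeDistribution) {n₀ M k : ℕ}
    (hk : ∀ j ∈ d.coeff.support, j ∣ k) (f : Fin M → Fin n₀)
    (hf : ∀ u, (Finset.univ.filter fun e => f e = u).card = k)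
    (τ : Equiv.Perm (Fin n₀)) (e e' : Fin M) :
    splitEnd d hk f hf τ e' = splitEnd d hk f hf τ e ↔
      f e' = f e ∧ edgeRank f e' / d.slotDegree n₀ (τ.symm (f e)) =
        edgeRank f e / d.slotDegree n₀ (τ.symm (f e)) := by
  rw [splitEnd_eq_mk_iff]
  simp [splitEnd]

theorem sum_fin_castLE {m k : ℕ} (h : m ≤ k) (g : Fin k → ℝ) :
    ∑ j : Fin m, g (Fin.castLE h j) = ∑ j : Fin k, if (j : ℕ) < m then g j else 0 := by
  refine Fintype.sum_of_injective (Fin.castLE h) (Fin.castLE_injective h) _ _ (fun j hj => ?_)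
    (fun j => by simp)
  rw [if_neg]
  exact fun hlt => hj ⟨⟨j, hlt⟩, rfl⟩

namespace DegreeDistributionPair

variable (P : DegreeDistributionPair) {n₀ : ℕ}

theorem dvd_degLcm_of_mem_left : ∀ j ∈ P.lam.coeff.support, j ∣ P.degLcm := fun _ hj =>
  Finset.dvd_lcm (f := id) (Finset.mem_union_left _ hj)

theorem dvd_degLcm_of_mem_right : ∀ j ∈ P.rho.coeff.support, j ∣ P.degLcm := fun _ hj =>
  Finset.dvd_lcm (f := id) (Finset.mem_union_right _ hj)

/-- The degree assigned to a slot on the left. -/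
noncomputable def leftDegree (s : Fin n₀) : ℕ := P.lam.slotDegree n₀ s

/-- The degree assigned to a slot on the right. -/
noncomputable def rightDegree (s : Fin n₀) : ℕ := P.rho.slotDegree n₀ s

/-- The outcome at each vertex that is given by slots for the vertices and by erasure bits. -/
def outcome {k : ℕ} (g h : Fin n₀ → Fin n₀) (b : Fin n₀ ⊕ Fin n₀ → Fin k → Bool)
    (w : Fin n₀ ⊕ Fin n₀) : Fin n₀ × (Fin k → Bool) :=
  (Sum.elim g h w, b w)

/-- The bit of the outcome that says whether a variable node is erased. -/
noncomputable def nodeBit (σ : Equiv.Perm (Fin n₀)) (v : P.lam.SplitNode n₀ P.degLcm) :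
    (Fin n₀ ⊕ Fin n₀) × Fin P.degLcm :=
  (Sum.inl (σ v.1), Fin.castLE (Nat.div_le_self _ _) v.2)

theorem nodeBit_injective (σ : Equiv.Perm (Fin n₀)) : Function.Injective (P.nodeBit σ) := by
  rintro ⟨s, j⟩ ⟨s', j'⟩ h
  simp only [nodeBit, Prod.mk.injEq, Sum.inl.injEq, σ.injective.eq_iff] at h
  obtain ⟨rfl, h⟩ := h
  rw [(Fin.castLE_injective _) h]

variable (G : OrderedRegularBipartiteGraph n₀ P.degLcm) (σ π : Equiv.Perm (Fin n₀))
  (b : Fin n₀ ⊕ Fin n₀ → Fin P.degLcm → Bool)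

theorem filter_var_eq_siblingEdges (e : Fin (n₀ * P.degLcm))
    [DecidablePred fun e' => e' ≠ e ∧
      (P.tannerGraph G σ π).var e' = (P.tannerGraph G σ π).var e] :
    (Finset.univ.filter fun e' => e' ≠ e ∧
      (P.tannerGraph G σ π).var e' = (P.tannerGraph G σ π).var e) =
    siblingEdges G.left (P.leftDegree (σ.symm (G.left e))) e := by
  ext e'
  rw [mem_siblingEdges, Finset.mem_filter, and_iff_right (Finset.mem_univ _)]
  exact and_congr_right' (splitEnd_eq_splitEnd_iff P.lam P.dvd_degLcm_of_mem_left G.left G.left_regular σ e e')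

theorem filter_chk_eq_siblingEdges (e : Fin (n₀ * P.degLcm))
    [DecidablePred fun e' => e' ≠ e ∧
      (P.tannerGraph G σ π).chk e' = (P.tannerGraph G σ π).chk e] :
    (Finset.univ.filter fun e' => e' ≠ e ∧
      (P.tannerGraph G σ π).chk e' = (P.tannerGraph G σ π).chk e) =
    siblingEdges G.right (P.rightDegree (π.symm (G.right e))) e := by
  ext e'
  rw [mem_siblingEdges, Finset.mem_filter, and_iff_right (Finset.mem_univ _)]
  exact and_congr_right' (splitEnd_eq_splitEnd_iff P.rho P.dvd_degLcm_of_mem_right G.right G.right_regular π e e')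

theorem filter_var_eq_nodeEdges (v : P.lam.SplitNode n₀ P.degLcm)
    [DecidablePred fun e => (P.tannerGraph G σ π).var e = v] :
    (Finset.univ.filter fun e => (P.tannerGraph G σ π).var e = v) =
    nodeEdges G.left (P.leftDegree v.1) (σ v.1) v.2 := by
  ext e
  rw [nodeEdges, Finset.mem_filter, Finset.mem_filter, and_iff_right (Finset.mem_univ _),
    and_iff_right (Finset.mem_univ _)]
  exact splitEnd_eq_mk_iff P.lam P.dvd_degLcm_of_mem_left G.left G.left_regular σ e v

open scoped Classical in
theorem varMsg_eq_ite {x : P.lam.SplitNode n₀ P.degLcm → ZMod 2} {t : ℕ}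
    {m : Fin (n₀ * P.degLcm) → Option (ZMod 2)}
    (hm : ∀ e, G.checkMsg P.leftDegree P.rightDegree (outcome σ.symm π.symm b) t e =
      if m e = none then 1 else 0) (e : Fin (n₀ * P.degLcm)) :
    G.varMsg P.leftDegree P.rightDegree (outcome σ.symm π.symm b) t e =
      if (P.tannerGraph G σ π).varToChk (TannerGraph.received x (Finset.univ.filter fun v =>
        b (P.nodeBit σ v).1 (P.nodeBit σ v).2 = true)) m e = none then 1 else 0 := by
  have h1 : ∀ e', (b (P.nodeBit σ ((P.tannerGraph G σ π).var e')).1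
      (P.nodeBit σ ((P.tannerGraph G σ π).var e')).2 = true) ↔
      (b (Sum.inl (G.left e'))
        (G.leftNodeIndex (P.leftDegree (σ.symm (G.left e'))) e') = true) := fun e' => by
    simp only [nodeBit, tannerGraph, splitEnd, Equiv.apply_symm_apply]
    rfl
  have h2 : (P.tannerGraph G σ π).varToChk (TannerGraph.received x (Finset.univ.filter fun v =>
        b (P.nodeBit σ v).1 (P.nodeBit σ v).2 = true)) m e = none ↔
      b (Sum.inl (G.left e)) (G.leftNodeIndex (P.leftDegree (σ.symm (G.left e))) e) = true ∧
        ∀ e' ∈ siblingEdges G.left (P.leftDegree (σ.symm (G.left e))) e, m e' = none := by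
    rw [TannerGraph.varToChk, TannerGraph.varRule_eq_none_iff, TannerGraph.received_eq_none_iff,
      Finset.mem_filter, h1, filter_var_eq_siblingEdges, and_iff_right (Finset.mem_univ _)]
  simp only [OrderedRegularBipartiteGraph.varMsg, hm, outcome, Sum.elim_inl, h2]
  rw [prod_ite_one_zero]
  split_ifs <;> simp_all

open scoped Classical in
-- The outcome uses inverse permutations because `σ` sends slots to vertices, whereas an outcome
-- gives each vertex its slot. The word `x` occurs on the right only.
theorem checkMsg_eq_ite (x : P.lam.SplitNode n₀ P.degLcm → ZMod 2) (t : ℕ)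
    (e : Fin (n₀ * P.degLcm)) :
    G.checkMsg P.leftDegree P.rightDegree (outcome σ.symm π.symm b) t e =
      if (P.tannerGraph G σ π).chkToVar (TannerGraph.received x (Finset.univ.filter fun v =>
        b (P.nodeBit σ v).1 (P.nodeBit σ v).2 = true)) t e = none then 1 else 0 := by
  induction t generalizing e with
  | zero => simp [OrderedRegularBipartiteGraph.checkMsg, TannerGraph.chkToVar]
  | succ t ih =>
    set m := (P.tannerGraph G σ π).varToChk (TannerGraph.received x (Finset.univ.filter fun v =>
        b (P.nodeBit σ v).1 (P.nodeBit σ v).2 = true)) ((P.tannerGraph G σ π).chkToVar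
          (TannerGraph.received x (Finset.univ.filter fun v =>
        b (P.nodeBit σ v).1 (P.nodeBit σ v).2 = true)) t) with hm
    have h1 : ∀ (q : Prop) [Decidable q], (1 - if q then (1 : ℝ) else 0) = if ¬ q then 1 else 0 := fun q _ => by
      split_ifs <;> simp_all
    have h2 : (P.tannerGraph G σ π).chkToVar (TannerGraph.received x (Finset.univ.filter fun v =>
        b (P.nodeBit σ v).1 (P.nodeBit σ v).2 = true)) (t + 1) e = none ↔
        ¬ ∀ e' ∈ siblingEdges G.right (P.rightDegree (π.symm (G.right e))) e, ¬ m e' = none := by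
      rw [TannerGraph.chkToVar, TannerGraph.chkRule_eq_none_iff, filter_chk_eq_siblingEdges]
      push Not
      rfl
    simp only [OrderedRegularBipartiteGraph.checkMsg_succ, P.varMsg_eq_ite G σ π b (x := x) ih, h1,
      outcome, Sum.elim_inr, h2]
    rw [prod_ite_one_zero, one_mul, h1]

open scoped Classical in
theorem card_unknown_eq (x : P.lam.SplitNode n₀ P.degLcm → ZMod 2) (t : ℕ) :
    ((Finset.univ.filter fun v => (P.tannerGraph G σ π).estimate
      (TannerGraph.received x (Finset.univ.filter fun v =>
        b (P.nodeBit σ v).1 (P.nodeBit σ v).2 = true)) t v = none).card : ℝ) =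
    ∑ u, G.rootMsg P.leftDegree P.rightDegree (outcome σ.symm π.symm b) t u := by
  have h1 : ∀ v : P.lam.SplitNode n₀ P.degLcm, (P.tannerGraph G σ π).estimate
      (TannerGraph.received x (Finset.univ.filter fun v =>
        b (P.nodeBit σ v).1 (P.nodeBit σ v).2 = true)) t v = none ↔
      b (P.nodeBit σ v).1 (P.nodeBit σ v).2 = true ∧
        ∀ e ∈ nodeEdges G.left (P.leftDegree v.1) (σ v.1) v.2, (P.tannerGraph G σ π).chkToVar
          (TannerGraph.received x (Finset.univ.filter fun v =>
            b (P.nodeBit σ v).1 (P.nodeBit σ v).2 = true)) t e = none := fun v => by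
    rw [TannerGraph.estimate, TannerGraph.varRule_eq_none_iff, TannerGraph.received_eq_none_iff,
      Finset.mem_filter, filter_var_eq_nodeEdges, and_iff_right (Finset.mem_univ _)]
  -- Variable nodes are grouped by slot, and slot `s` belongs to the vertex `σ s`.
  rw [Finset.card_filter, Nat.cast_sum, Fintype.sum_sigma, ← Equiv.sum_comp σ fun u =>
    G.rootMsg P.leftDegree P.rightDegree (outcome σ.symm π.symm b) t u]
  refine Finset.sum_congr rfl fun s _ => ?_
  have h := sum_fin_castLE (Nat.div_le_self P.degLcm (P.leftDegree s))
    (fun j => (if b (Sum.inl (σ s)) j then 1 else 0) *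
      ∏ e ∈ nodeEdges G.left (P.leftDegree s) (σ s) j,
        G.checkMsg P.leftDegree P.rightDegree (outcome σ.symm π.symm b) t e)
  simp only [OrderedRegularBipartiteGraph.rootMsg, outcome, Sum.elim_inl, Equiv.symm_apply_apply]
  refine Eq.trans (Eq.trans (Finset.sum_congr rfl fun j _ => ?_) h)
    (Finset.sum_congr rfl fun j _ => ?_)
  · simp only [P.checkMsg_eq_ite G σ π b x, h1]
    rw [prod_ite_one_zero]
    have h2 : ∀ (A B : Prop) [Decidable A] [Decidable B] [Decidable (A ∧ B)],
        ((if A ∧ B then 1 else 0 : ℕ) : ℝ) = (if A then 1 else 0) * (if B then 1 else 0) :=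
      fun A B _ _ _ => by split_ifs <;> simp_all
    exact h2 _ _
  · unfold outcome
    split_ifs <;> simp

theorem bitErrorProb_eq (ε : ℝ) (t : ℕ) :
    (P.tannerGraph G σ π).bitErrorProb ε t =
      (∑ b : Fin n₀ ⊕ Fin n₀ → Fin P.degLcm → Bool, (∏ w, ∏ j, bitWeight ε (b w j)) *
        ∑ u, G.rootMsg P.leftDegree P.rightDegree (outcome σ.symm π.symm b) t u) /
      P.blockLength n₀ := by
  classical
  rw [TannerGraph.bitErrorProb, div_eq_iff
    (by exact_mod_cast (P.tannerGraph G σ π).code_card_pos.ne'), mul_comm (_ / _), ← nsmul_eq_mul,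
    ← Finset.sum_const]
  -- Every codeword contributes the same amount, so the average over the code disappears.
  refine Finset.sum_congr rfl fun x _ => ?_
  refine (sum_powerset_eq_sum_bits ε _).trans ?_
  refine (sum_bits_comp_injective ε (P.nodeBit_injective σ) fun c => _).symm.trans ?_
  rw [← Equiv.sum_comp (Equiv.curry (Fin n₀ ⊕ Fin n₀) (Fin P.degLcm) Bool).symm, Finset.sum_div]
  refine Finset.sum_congr rfl fun b _ => ?_
  rw [← card_unknown_eq, Fintype.prod_prod_type, mul_div_assoc]
  rfl

end DegreeDistributionPair

/-! ### Slot counts and degree polynomials -/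

namespace DegreeDistribution

variable (d : DegreeDistribution) {n₀ : ℕ}

/-- The fraction of edges at nodes of degree less than `j`. -/
noncomputable def cumulative (j : ℕ) : ℚ := ∑ l ∈ Finset.range j, d.coeff l

theorem cumulative_mono : Monotone d.cumulative := fun _ _ h =>
  Finset.sum_le_sum_of_subset_of_nonneg (Finset.range_mono h) fun l _ _ => d.coeff_nonneg l

theorem cumulative_le_one (j : ℕ) : d.cumulative j ≤ 1 := by
  rw [← d.sum_coeff, cumulative, ← Finset.sum_filter_add_sum_filter_not (Finset.range j)
    (fun l => l ∈ d.coeff.support),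
    Finset.sum_eq_zero (s := (Finset.range j).filter fun l => ¬ l ∈ d.coeff.support), add_zero]
  · refine Finset.sum_le_sum_of_subset_of_nonneg (fun l hl => (Finset.mem_filter.1 hl).2)
      fun l _ _ => d.coeff_nonneg l
  · exact fun l hl => Finsupp.notMem_support_iff.1 (Finset.mem_filter.1 hl).2

theorem slotDegree_le_iff {i : ℕ} (hi : i < n₀) (j : ℕ) :
    d.slotDegree n₀ i ≤ j ↔ (i : ℚ) < n₀ * d.cumulative (j + 1) := by
  constructor
  · intro h
    have hne : {j : ℕ | (i : ℚ) < n₀ * ∑ l ∈ Finset.range (j + 1), d.coeff l}.Nonempty := by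
      rw [Set.nonempty_iff_ne_empty]
      intro he
      have h0 := d.slotDegree_mem_support hi
      rw [slotDegree, he, Nat.sInf_empty, Finsupp.mem_support_iff] at h0
      exact h0 d.coeff_zero
    have hm : (i : ℚ) < n₀ * d.cumulative (d.slotDegree n₀ i + 1) := Nat.sInf_mem hne
    exact hm.trans_le (mul_le_mul_of_nonneg_left (d.cumulative_mono (by lia)) (by positivity))
  · exact fun h => Nat.sInf_le h

theorem slotDegree_eq_iff {i : ℕ} (hi : i < n₀) (j : ℕ) :
    d.slotDegree n₀ i = j ↔ n₀ * d.cumulative j ≤ i ∧ (i : ℚ) < n₀ * d.cumulative (j + 1) := by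
  rw [← d.slotDegree_le_iff hi, le_antisymm_iff, and_comm]
  refine and_congr_left' ?_
  rcases j with _ | j
  · simp [cumulative]
  · rw [← not_lt, ← not_lt, Nat.lt_succ_iff, d.slotDegree_le_iff hi]

theorem exists_nat_eq_mul_cumulative (hd : ∀ i, ∃ m : ℕ, (n₀ : ℚ) * d.coeff i = m) (j : ℕ) :
    ∃ m : ℕ, (n₀ : ℚ) * d.cumulative j = m := by
  choose c hc using hd
  exact ⟨∑ l ∈ Finset.range j, c l, by simp [cumulative, Finset.mul_sum, hc]⟩

/-- The slots of degree j form the interval between n₀ times two consecutive cumulative sums.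
Admissibility makes its ends integers, so there is no rounding. -/
theorem card_slotDegree_eq (hd : ∀ i, ∃ m : ℕ, (n₀ : ℚ) * d.coeff i = m) (j : ℕ) :
    ((Finset.univ.filter fun s : Fin n₀ => d.slotDegree n₀ s = j).card : ℚ) = n₀ * d.coeff j := by
  obtain ⟨a, ha⟩ := d.exists_nat_eq_mul_cumulative hd j
  obtain ⟨b, hb⟩ := d.exists_nat_eq_mul_cumulative hd (j + 1)
  have hab : a ≤ b := by
    have : (a : ℚ) ≤ b := by
      rw [← ha, ← hb]
      exact mul_le_mul_of_nonneg_left (d.cumulative_mono (by lia)) (by positivity)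
    exact_mod_cast this
  have hbn : b ≤ n₀ := by
    have : (b : ℚ) ≤ n₀ := by
      rw [← hb]
      exact mul_le_of_le_one_right (by positivity) (d.cumulative_le_one _)
    exact_mod_cast this
  have hcard : (Finset.univ.filter fun s : Fin n₀ => d.slotDegree n₀ s = j).card = b - a := by
    rw [← Nat.card_Ico, ← Finset.card_map Fin.valEmbedding]
    congr 1
    ext i
    simp only [Finset.mem_map, Finset.mem_filter, Finset.mem_univ, true_and, Fin.valEmbedding_apply,
      Finset.mem_Ico]
    constructor
    · rintro ⟨s, hs, rfl⟩
      rw [d.slotDegree_eq_iff s.isLt, ha, hb] at hs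
      exact_mod_cast hs
    · rintro ⟨h1, h2⟩
      refine ⟨⟨i, by lia⟩, ?_, rfl⟩
      rw [d.slotDegree_eq_iff (by simp; lia), ha, hb]
      exact_mod_cast And.intro h1 h2
  rw [hcard, Nat.cast_sub hab, ← ha, ← hb, cumulative, cumulative, Finset.sum_range_succ]
  ring

theorem sum_slotDegree (hd : ∀ i, ∃ m : ℕ, (n₀ : ℚ) * d.coeff i = m) (f : ℕ → ℝ) :
    ∑ s : Fin n₀, f (d.slotDegree n₀ s) =
      n₀ * ∑ j ∈ d.coeff.support, (d.coeff j : ℝ) * f j := by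
  rw [← Finset.sum_fiberwise_of_maps_to (s := Finset.univ) (t := d.coeff.support)
    (g := fun s : Fin n₀ => d.slotDegree n₀ s) (fun s _ => d.slotDegree_mem_support s.isLt),
    Finset.mul_sum]
  refine Finset.sum_congr rfl fun j _ => ?_
  rw [Finset.sum_congr rfl (g := fun _ => f j) fun s hs => by rw [(Finset.mem_filter.1 hs).2],
    Finset.sum_const, nsmul_eq_mul]
  have h : ((Finset.univ.filter fun s : Fin n₀ => d.slotDegree n₀ s = j).card : ℝ) =
      n₀ * (d.coeff j : ℝ) := by
    exact_mod_cast congrArg (fun q : ℚ => (q : ℝ)) (d.card_slotDegree_eq hd j)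
  rw [h, mul_assoc]

theorem pos_of_mem_support {j : ℕ} (hj : j ∈ d.coeff.support) : 0 < j := by
  rw [Nat.pos_iff_ne_zero]
  rintro rfl
  exact Finsupp.mem_support_iff.1 hj d.coeff_zero

theorem sum_coeff_div_pos : 0 < ∑ j ∈ d.coeff.support, (d.coeff j : ℝ) / j := by
  refine Finset.sum_pos (fun j hj => ?_) ?_
  · have h1 : 0 < d.coeff j := lt_of_le_of_ne (d.coeff_nonneg j)
      (Finsupp.mem_support_iff.1 hj).symm
    have h2 := d.pos_of_mem_support hj
    positivity
  · rw [Finset.nonempty_iff_ne_empty]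
    intro he
    have h := d.sum_coeff
    rw [he, Finset.sum_empty] at h
    exact zero_ne_one h

theorem edgePoly_one : d.edgePoly 1 = 1 := by
  simp only [edgePoly, one_pow, mul_one]
  exact_mod_cast d.sum_coeff

theorem nodePoly_one : d.nodePoly 1 = 1 := by
  simp only [nodePoly, one_pow, mul_one, nodeFraction]
  rw [← Finset.sum_div, div_self d.sum_coeff_div_pos.ne']

theorem sum_pow_slotDegree_sub_one (hd : ∀ i, ∃ m : ℕ, (n₀ : ℚ) * d.coeff i = m) (hn : n₀ ≠ 0)
    (z : ℝ) : (∑ s : Fin n₀, z ^ (d.slotDegree n₀ s - 1)) / n₀ = d.edgePoly z := by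
  have hn' : (n₀ : ℝ) ≠ 0 := by exact_mod_cast hn
  rw [d.sum_slotDegree hd fun j => z ^ (j - 1), edgePoly, mul_div_cancel_left₀ _ hn']

/-- A uniform slot has the edge-perspective degree law. Weighting a slot of degree j by its k/j
nodes turns this into the node-perspective law, with the number of nodes as normalisation. -/
theorem sum_div_slotDegree_mul_pow (hd : ∀ i, ∃ m : ℕ, (n₀ : ℚ) * d.coeff i = m) {k : ℕ}
    (hk : ∀ j ∈ d.coeff.support, j ∣ k) (z : ℝ) :
    ∑ s : Fin n₀, ((k / d.slotDegree n₀ s : ℕ) : ℝ) * z ^ d.slotDegree n₀ s =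
      (Fintype.card (d.SplitNode n₀ k) : ℝ) * d.nodePoly z := by
  have hcard : (Fintype.card (d.SplitNode n₀ k) : ℝ) =
      n₀ * k * ∑ j ∈ d.coeff.support, (d.coeff j : ℝ) / j := by
    rw [Fintype.card_sigma]
    simp only [Fintype.card_fin]
    rw [Nat.cast_sum, d.sum_slotDegree hd fun j => ((k / j : ℕ) : ℝ), mul_assoc, Finset.mul_sum _ _ (k : ℝ)]
    congr 1
    refine Finset.sum_congr rfl fun j hj => ?_
    rw [Nat.cast_div (hk j hj) (by exact_mod_cast (d.pos_of_mem_support hj).ne')]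
    ring
  rw [d.sum_slotDegree hd fun j => ((k / j : ℕ) : ℝ) * z ^ j, hcard, nodePoly, mul_assoc, mul_assoc,
    Finset.mul_sum _ _ (∑ j ∈ d.coeff.support, (d.coeff j : ℝ) / j), Finset.mul_sum _ _ (k : ℝ)]
  congr 1
  refine Finset.sum_congr rfl fun j hj => ?_
  have h := d.sum_coeff_div_pos.ne'
  rw [Nat.cast_div (hk j hj) (by exact_mod_cast (d.pos_of_mem_support hj).ne'), nodeFraction]
  field_simp

end DegreeDistribution

/-! ### Bounds on the erasure indicators -/

namespace OrderedRegularBipartiteGraph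

variable {n₀ k : ℕ} (G : OrderedRegularBipartiteGraph n₀ k) (dl dr : Fin n₀ → ℕ)

theorem varMsg_mem_Icc {ω : Fin n₀ ⊕ Fin n₀ → Fin n₀ × (Fin k → Bool)} {t : ℕ}
    (h : ∀ e, G.checkMsg dl dr ω t e ∈ Set.Icc 0 1) (e : Fin (n₀ * k)) :
    G.varMsg dl dr ω t e ∈ Set.Icc 0 1 := by
  have h0 := Finset.prod_nonneg (s := siblingEdges G.left (dl (ω (Sum.inl (G.left e))).1) e)
    fun e' _ => (h e').1
  have h1 := Finset.prod_le_one (s := siblingEdges G.left (dl (ω (Sum.inl (G.left e))).1) e)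
    (fun e' _ => (h e').1) fun e' _ => (h e').2
  rw [varMsg]
  split_ifs
  · rw [one_mul]
    exact ⟨h0, h1⟩
  · simp

theorem checkMsg_mem_Icc (ω : Fin n₀ ⊕ Fin n₀ → Fin n₀ × (Fin k → Bool)) (t : ℕ)
    (e : Fin (n₀ * k)) : G.checkMsg dl dr ω t e ∈ Set.Icc 0 1 := by
  induction t generalizing e with
  | zero => simp [checkMsg]
  | succ t ih =>
    have h := G.varMsg_mem_Icc dl dr ih
    have h0 := Finset.prod_nonneg
      (s := siblingEdges G.right (dr (ω (Sum.inr (G.right e))).1) e)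
      fun e' _ => sub_nonneg.2 (h e').2
    have h1 := Finset.prod_le_one
      (s := siblingEdges G.right (dr (ω (Sum.inr (G.right e))).1) e)
      (fun e' _ => sub_nonneg.2 (h e').2) fun e' _ => sub_le_self _ (h e').1
    rw [checkMsg_succ, one_mul]
    exact ⟨sub_nonneg.2 h1, sub_le_self _ h0⟩

theorem rootMsg_nonneg (ω : Fin n₀ ⊕ Fin n₀ → Fin n₀ × (Fin k → Bool)) (t : ℕ) (u : Fin n₀) :
    0 ≤ G.rootMsg dl dr ω t u := by
  refine Finset.sum_nonneg fun j _ => mul_nonneg (mul_nonneg ?_ ?_)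
    (Finset.prod_nonneg fun e _ => (G.checkMsg_mem_Icc dl dr ω t e).1)
  all_goals split_ifs <;> norm_num

end OrderedRegularBipartiteGraph

theorem bitWeight_nonneg {ε : ℝ} (h0 : 0 ≤ ε) (h1 : ε ≤ 1) (b : Bool) : 0 ≤ bitWeight ε b := by
  cases b <;> simp [bitWeight, h0, h1]

theorem TannerGraph.bitErrorProb_nonneg {V C E : Type*} [Fintype V] [Fintype C] [Fintype E]
    (T : TannerGraph V C E) {ε : ℝ} (h0 : 0 ≤ ε) (h1 : ε ≤ 1) (t : ℕ) :
    0 ≤ T.bitErrorProb ε t := by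
  have := sub_nonneg.2 h1
  unfold bitErrorProb
  positivity

/-! ### The bound for a fixed number of iterations -/

namespace DegreeDistributionPair

variable (P : DegreeDistributionPair) {n₀ : ℕ}

theorem degLcm_pos : 0 < P.degLcm := by
  rw [Nat.pos_iff_ne_zero, degLcm, Ne, Finset.lcm_eq_zero_iff]
  rintro ⟨j, hj, hj0⟩
  rcases Finset.mem_union.1 hj with h | h
  · exact (P.lam.pos_of_mem_support h).ne' hj0
  · exact (P.rho.pos_of_mem_support h).ne' hj0

/-- Density evolution for the check-to-variable messages. -/
noncomputable def checkErasure (ε : ℝ) : ℕ → ℝ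
  | 0 => 1
  | t + 1 => 1 - P.rho.edgePoly (1 - P.x ε t)

/-- Starting `checkErasure` at 1 brings the initial value ε under the general formula, because λ(1)
= 1. -/
theorem x_eq (ε : ℝ) (t : ℕ) : P.x ε t = ε * P.lam.edgePoly (P.checkErasure ε t) := by
  cases t with
  | zero => rw [checkErasure, P.lam.edgePoly_one, mul_one, x]
  | succ t => rfl

theorem y_eq (ε : ℝ) (t : ℕ) : P.y ε t = ε * P.lam.nodePoly (P.checkErasure ε t) := by
  cases t with
  | zero => rw [checkErasure, P.lam.nodePoly_one, mul_one, y]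
  | succ t => rfl

theorem prodExpect_slotWeight_eq {k : ℕ} (ε : ℝ)
    (R : (Fin n₀ ⊕ Fin n₀ → Fin n₀ × (Fin k → Bool)) → ℝ) :
    prodExpect (slotWeight ε) R =
      (∑ g : Fin n₀ → Fin n₀, ∑ h : Fin n₀ → Fin n₀, ∑ b : Fin n₀ ⊕ Fin n₀ → Fin k → Bool,
        (∏ w, ∏ j, bitWeight ε (b w j)) * R (outcome g h b)) /
        ((n₀ : ℝ) ^ n₀ * (n₀ : ℝ) ^ n₀) := by
  rw [prodExpect, ← Equiv.sum_comp ((Equiv.prodCongr (Equiv.sumArrowEquivProdArrow _ _ _).symm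
      (Equiv.refl _)).trans (Equiv.arrowProdEquivProdArrow (Fin n₀ ⊕ Fin n₀) (fun _ => Fin n₀)
        (fun _ => Fin k → Bool)).symm), Fintype.sum_prod_type, Fintype.sum_prod_type,
    Finset.sum_div]
  refine Finset.sum_congr rfl fun g _ => ?_
  rw [Finset.sum_div]
  refine Finset.sum_congr rfl fun h _ => ?_
  rw [Finset.sum_div]
  refine Finset.sum_congr rfl fun b _ => ?_
  change (∏ w, slotWeight ε (outcome g h b w)) * R (outcome g h b) = _
  simp only [slotWeight, outcome]
  rw [Finset.prod_mul_distrib, Finset.prod_const, Finset.card_univ, Fintype.card_sum,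
    Fintype.card_fin, pow_add, inv_pow, div_eq_mul_inv, mul_inv]
  ring

variable {P}

/-- The comparison is made root by root: one root involves few vertices, whereas the sum over all
roots depends on every slot. The erasure bits are averaged first, since only the slots change from
functions to permutations. -/
theorem average_rootMsg_le (hP : P.Admissible n₀) {t : ℕ}
    (hm : ((P.degLcm + 2) ^ (2 * t + 1)) ^ 2 < n₀)
    (G : OrderedRegularBipartiteGraph n₀ P.degLcm)
    (hg : ((4 * t + 2 : ℕ) : ℕ∞) ≤ G.toSimpleGraph.egirth) {ε : ℝ} (h0 : 0 ≤ ε) (h1 : ε ≤ 1)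
    (u : Fin n₀) :
    (1 - 2 * (((P.degLcm + 2) ^ (2 * t + 1) : ℕ) : ℝ) ^ 2 / n₀) *
      ((∑ σ : Equiv.Perm (Fin n₀), ∑ π : Equiv.Perm (Fin n₀),
        ∑ b : Fin n₀ ⊕ Fin n₀ → Fin P.degLcm → Bool, (∏ w, ∏ j, bitWeight ε (b w j)) *
          G.rootMsg P.leftDegree P.rightDegree (outcome σ π b) t u) /
        ((n₀.factorial : ℝ) * n₀.factorial)) ≤
      (P.blockLength n₀ : ℝ) * P.y ε t / n₀ := by
  have hn : n₀ ≠ 0 := by lia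
  have hdl : ∀ s : Fin n₀, 0 < P.leftDegree s ∧ P.leftDegree s ∣ P.degLcm := fun s =>
    have h := P.lam.slotDegree_mem_support s.isLt
    ⟨P.lam.pos_of_mem_support h, P.dvd_degLcm_of_mem_left _ h⟩
  have hdr : ∀ s : Fin n₀, 0 < P.rightDegree s ∧ P.rightDegree s ∣ P.degLcm := fun s =>
    have h := P.rho.slotDegree_mem_support s.isLt
    ⟨P.rho.pos_of_mem_support h, P.dvd_degLcm_of_mem_right _ h⟩
  have hcard : ∀ f : Fin n₀ ↪ Fin n₀ ⊕ Fin n₀,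
      (Finset.univ.filter fun v => f v ∈ G.rootSupport t u).card ≤
        (P.degLcm + 2) ^ (2 * t + 1) := fun f => by
    rw [← Finset.card_map f]
    refine (Finset.card_le_card fun w hw => ?_).trans (G.card_rootSupport_lt t u).le
    obtain ⟨v, hv, rfl⟩ := Finset.mem_map.1 hw
    exact (Finset.mem_filter.1 hv).2
  have hE : prodExpect (slotWeight ε)
      (fun ω => G.rootMsg P.leftDegree P.rightDegree ω t u) =
      (P.blockLength n₀ : ℝ) * P.y ε t / n₀ := by
    rw [G.prodExpect_rootMsg hn hdl hdr ε (z := P.checkErasure ε) rfl (fun t => ?_) t hg u, y_eq]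
    · simp only [leftDegree]
      rw [P.lam.sum_div_slotDegree_mul_pow hP.1 P.dvd_degLcm_of_mem_left, blockLength]
      ring
    · simp only [leftDegree, rightDegree]
      rw [P.lam.sum_pow_slotDegree_sub_one hP.1 hn, P.rho.sum_pow_slotDegree_sub_one hP.2 hn,
        ← x_eq, checkErasure]
  rw [← hE, prodExpect_slotWeight_eq]
  refine two_perm_average_le hm (hcard Function.Embedding.inl) (hcard Function.Embedding.inr)
    (F := fun g h => ∑ b : Fin n₀ ⊕ Fin n₀ → Fin P.degLcm → Bool,
      (∏ w, ∏ j, bitWeight ε (b w j)) *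
        G.rootMsg P.leftDegree P.rightDegree (outcome g h b) t u) ?_ ?_ ?_
  · exact fun g h => Finset.sum_nonneg fun b _ => mul_nonneg
      (Finset.prod_nonneg fun w _ => Finset.prod_nonneg fun j _ => bitWeight_nonneg h0 h1 _)
      (G.rootMsg_nonneg _ _ _ _ _)
  · intro h g g' hgg
    refine Finset.sum_congr rfl fun b _ => congrArg _
      (G.dependsOn_rootMsg _ _ t u fun w hw => ?_)
    rcases w with w | w
    · simp only [outcome, Sum.elim_inl]
      rw [hgg w (by simpa using hw)]
    · rfl
  · intro g h h' hhh
    refine Finset.sum_congr rfl fun b _ => congrArg _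
      (G.dependsOn_rootMsg _ _ t u fun w hw => ?_)
    rcases w with w | w
    · rfl
    · simp only [outcome, Sum.elim_inr]
      rw [hhh w (by simpa using hw)]

/-- The inverse of a uniform permutation is uniform, so the inverses in the outcome can be dropped.
-/
theorem expectedBitErrorProb_eq (G : OrderedRegularBipartiteGraph n₀ P.degLcm) (ε : ℝ) (t : ℕ) :
    P.expectedBitErrorProb G ε t = (∑ u, (∑ σ : Equiv.Perm (Fin n₀), ∑ π : Equiv.Perm (Fin n₀),
        ∑ b : Fin n₀ ⊕ Fin n₀ → Fin P.degLcm → Bool, (∏ w, ∏ j, bitWeight ε (b w j)) *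
          G.rootMsg P.leftDegree P.rightDegree (outcome σ π b) t u) /
        ((n₀.factorial : ℝ) * n₀.factorial)) / P.blockLength n₀ := by
  have hswap : ∀ X : Fin n₀ → Equiv.Perm (Fin n₀) → Equiv.Perm (Fin n₀) → ℝ,
      ∑ u, ∑ σ, ∑ π, X u σ π = ∑ σ, ∑ π, ∑ u, X u σ⁻¹ π⁻¹ := fun X => by
    rw [Finset.sum_comm, ← Equiv.sum_comp (Equiv.inv (Equiv.Perm (Fin n₀)))]
    refine Finset.sum_congr rfl fun σ _ => ?_
    rw [Finset.sum_comm, ← Equiv.sum_comp (Equiv.inv (Equiv.Perm (Fin n₀)))]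
    rfl
  rw [expectedBitErrorProb, Fintype.card_perm, Fintype.card_fin, ← Finset.sum_div, div_right_comm]
  congr 1
  rw [hswap, Finset.sum_div]
  refine Finset.sum_congr rfl fun σ _ => ?_
  rw [Finset.sum_div]
  refine Finset.sum_congr rfl fun π _ => ?_
  rw [bitErrorProb_eq, Finset.sum_comm]
  simp only [Finset.mul_sum]
  rfl

theorem one_sub_mul_expectedBitErrorProb_le (hP : P.Admissible n₀) {t : ℕ}
    (hm : ((P.degLcm + 2) ^ (2 * t + 1)) ^ 2 < n₀) (hN : P.blockLength n₀ ≠ 0)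
    (G : OrderedRegularBipartiteGraph n₀ P.degLcm)
    (hg : ((4 * t + 2 : ℕ) : ℕ∞) ≤ G.toSimpleGraph.egirth) {ε : ℝ} (h0 : 0 ≤ ε) (h1 : ε ≤ 1) :
    (1 - 2 * (((P.degLcm + 2) ^ (2 * t + 1) : ℕ) : ℝ) ^ 2 / n₀) * P.expectedBitErrorProb G ε t ≤
      P.y ε t := by
  have hN' : (0 : ℝ) < P.blockLength n₀ := by exact_mod_cast Nat.pos_of_ne_zero hN
  have hn : (n₀ : ℝ) ≠ 0 := by exact_mod_cast (by lia : n₀ ≠ 0)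
  rw [expectedBitErrorProb_eq, mul_div_assoc', div_le_iff₀ hN', Finset.mul_sum]
  refine (Finset.sum_le_sum fun u _ => average_rootMsg_le hP hm G hg h0 h1 u).trans (le_of_eq ?_)
  rw [Finset.sum_const, Finset.card_univ, Fintype.card_fin, nsmul_eq_mul]
  field_simp

theorem blockLength_le (n₀ : ℕ) : P.blockLength n₀ ≤ n₀ * P.degLcm := by
  rw [blockLength, Fintype.card_sigma]
  simp only [Fintype.card_fin]
  refine (Finset.sum_le_sum fun s _ => Nat.div_le_self _ _).trans (le_of_eq ?_)
  simp

end DegreeDistributionPair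

/-! ### Choice of constants and conclusion -/

/-- The constant 8 makes 4t log K at most (log n)/2, that is, K^(4t) ≤ √n. -/
theorem pow_two_mul_floor_le {K : ℕ} (hK : 2 ≤ K) {a : ℝ}
    (ha' : a ≤ 1 / (8 * Real.log K)) {n : ℕ} (hn : 0 < n) :
    (((K ^ (2 * ⌊a * Real.log n⌋₊ + 1) : ℕ) : ℝ)) ^ 2 ≤ (K : ℝ) ^ 2 * √n := by
  have hK1 : (1 : ℝ) < K := by exact_mod_cast (by lia : 1 < K)
  have hK0 : (0 : ℝ) < K := by linarith
  have hlog : 0 < Real.log K := Real.log_pos hK1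
  have hn0 : (0 : ℝ) < n := by exact_mod_cast hn
  have hlogn : 0 ≤ Real.log n := Real.log_natCast_nonneg n
  set t := ⌊a * Real.log n⌋₊ with ht
  have h1 : (t : ℝ) ≤ 1 / (8 * Real.log K) * Real.log n := by
    refine le_trans ?_ (Nat.floor_le (by positivity))
    exact_mod_cast Nat.floor_mono (mul_le_mul_of_nonneg_right ha' hlogn)
  have h2 : (K : ℝ) ^ (4 * t) ≤ √n := by
    rw [← Real.log_le_log_iff (by positivity) (by positivity), Real.log_pow, Real.log_sqrt hn0.le]
    push_cast
    calc 4 * (t : ℝ) * Real.log K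
        ≤ 4 * (1 / (8 * Real.log K) * Real.log n) * Real.log K := by gcongr
      _ = Real.log n / 2 := by field_simp; ring
  calc (((K ^ (2 * t + 1) : ℕ) : ℝ)) ^ 2 = (K : ℝ) ^ 2 * (K : ℝ) ^ (4 * t) := by
        push_cast
        rw [← pow_mul, ← pow_add]
        congr 1
        ring
    _ ≤ _ := by gcongr

theorem proposition1 (P : DegreeDistributionPair) :
    ∃ a₀ : ℝ, 0 < a₀ ∧ ∀ a : ℝ, 0 < a → a ≤ a₀ →
      ∀ δ : ℝ, 0 < δ → δ < 1 →
        ∃ N : ℕ, ∀ n₀ n t : ℕ, P.Admissible n₀ → n = P.blockLength n₀ → N ≤ n →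
          t = ⌊a * Real.log n⌋₊ →
          ∀ G : OrderedRegularBipartiteGraph n₀ P.degLcm,
            ((4 * t + 2 : ℕ) : ℕ∞) ≤ G.toSimpleGraph.egirth →
            ∀ ε : ℝ, 0 ≤ ε → ε ≤ 1 →
              P.expectedBitErrorProb G ε t ≤ 1 / (1 - δ) * P.y ε t := by
  have hk : (0 : ℝ) < P.degLcm := by exact_mod_cast P.degLcm_pos
  set K : ℕ := P.degLcm + 2 with hK
  have hlog : 0 < Real.log K := Real.log_pos (by exact_mod_cast (by lia : 1 < K))
  refine ⟨1 / (8 * Real.log K), by positivity, fun a _ ha' δ hδ hδ1 => ?_⟩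
  -- With √n ≥ `B` and n ≤ n₀k, the bound m² ≤ K²√n gives 2m² ≤ δn₀.
  set B : ℝ := 2 * (K : ℝ) ^ 2 * P.degLcm / δ with hB
  have hB0 : 0 < B := by positivity
  -- The summand 1 gives n > 0 at once, and hence n₀ > 0.
  refine ⟨⌈B ^ 2⌉₊ + 1, fun n₀ n t hP hn hNn ht G hg ε h0 h1 => ?_⟩
  have hnpos : 0 < n := by lia
  have hnR : (0 : ℝ) < n := by exact_mod_cast hnpos
  have hBn : B ≤ √n := by
    refine Real.le_sqrt_of_sq_le ((Nat.le_ceil _).trans ?_)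
    exact_mod_cast (Nat.le_succ _).trans hNn
  have hn₀ : (n : ℝ) ≤ n₀ * P.degLcm := by
    rw [hn]
    exact_mod_cast P.blockLength_le n₀
  have hm : 2 * ((K ^ (2 * t + 1) : ℕ) : ℝ) ^ 2 ≤ δ * n₀ := by
    have h2 := pow_two_mul_floor_le (by lia : 2 ≤ K) ha' hnpos
    rw [← ht] at h2
    have h3 : 2 * (K : ℝ) ^ 2 * P.degLcm ≤ δ * √n := by
      rw [hB, div_le_iff₀ hδ] at hBn
      linarith
    have h4 : √(n : ℝ) * √n = n := Real.mul_self_sqrt hnR.le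
    have h5 : 2 * (K : ℝ) ^ 2 * P.degLcm * √n ≤ δ * √n * √n :=
      mul_le_mul_of_nonneg_right h3 (Real.sqrt_nonneg _)
    have h6 : 2 * ((K ^ (2 * t + 1) : ℕ) : ℝ) ^ 2 * P.degLcm ≤ δ * n₀ * P.degLcm :=
      calc 2 * ((K ^ (2 * t + 1) : ℕ) : ℝ) ^ 2 * P.degLcm
          ≤ 2 * ((K : ℝ) ^ 2 * √n) * P.degLcm := by gcongr
        _ ≤ δ * (√n * √n) := by linarith
        _ ≤ δ * (n₀ * P.degLcm) := by rw [h4]; gcongr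
        _ = _ := by ring
    exact le_of_mul_le_mul_right h6 hk
  have hn₀pos : (0 : ℝ) < n₀ := by
    by_contra hcon
    have : (n₀ : ℝ) = 0 := le_antisymm (not_lt.1 hcon) (by positivity)
    rw [this, zero_mul] at hn₀
    linarith
  have hm' : (K ^ (2 * t + 1)) ^ 2 < n₀ := by
    have h2 : (0 : ℝ) ≤ ((K ^ (2 * t + 1) : ℕ) : ℝ) ^ 2 := by positivity
    have h3 : ((K ^ (2 * t + 1) : ℕ) : ℝ) ^ 2 < n₀ := by nlinarith
    exact_mod_cast h3
  have key := DegreeDistributionPair.one_sub_mul_expectedBitErrorProb_le hP hm' (by lia) G hg h0 h1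
  have hE : 0 ≤ P.expectedBitErrorProb G ε t := div_nonneg
    (Finset.sum_nonneg fun σ _ => Finset.sum_nonneg fun π _ =>
      TannerGraph.bitErrorProb_nonneg _ h0 h1 t) (by positivity)
  have hfrac : 2 * ((K ^ (2 * t + 1) : ℕ) : ℝ) ^ 2 / n₀ ≤ δ := by
    rwa [div_le_iff₀ hn₀pos]
  rw [one_div, ← div_eq_inv_mul, le_div_iff₀ (by linarith), mul_comm]
  exact le_trans (mul_le_mul_of_nonneg_right (by linarith) hE) key
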